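/- Let $J_1\ge 0$ be fixed, $I=(0,1)$, $S^1\subset\mathbb R^2$ the unit circle, $B_1\subset\mathbb R^2$ the closed unit ball, $(\cdot,\cdot)$ the scalar product of $\mathbb R^2$. For $N\in\mathbb N$ and $v:\{0,\dots,N\}\to S^1$ put $$\mathcal E_N(v)=-J_1\sum_{i=0}^{N-2}(v^i,v^{i+1})+\sum_{i=0}^{N-2}(v^i,v^{i+2}),$$ and let $\overline{\mathcal U}_N$ be the set of those $v$ with $(v^1,v^0)=(v^N,v^{N-1})$. Given positive numbers $\lambda_n\to0$, let $N_n=[1/\lambda_n]$ and (for $n$ so large that $\lambda_n\le1$) define $E_n:L^\infty(I,\mathbb R^2)\to(-\infty,+\infty]$ by $E_n(u)=\lambda_n\mathcal E_{N_n}(v)$ if there is $v\in\overline{\mathcal U}_{N_n}$ with $u=v^i$ a.e. on $I\cap\lambda_n(i+[0,1))$ for $i=0,\dots,N_n$, and $E_n(u)=+\infty$ otherwise. (If $\lambda_nN_n=1$, then $v^{N_n}$ is not determined by $u$, and the infimum over the possible $v$ is taken.) **Theorem.** There is a convex function $f_{hom}:B_1\to\mathbb R$, depending only on $J_1$, such that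 for every $z\in B_1$ $$f_{hom}(z)=\lim_{\rho\to0^+}\lim_{k\to\infty}\frac1k\inf\Big\{\mathcal E_k(v)\,:\,v\in\overline{\mathcal U}_k,\ \frac1{k-1}\sum_{i=1}^{k-1}v^i\in\overline B(z,\rho)\Big\},$$ where the limits exist and are finite, and such that for every sequence of positive numbers $\lambda_n\to0$ the functionals $E_n$ $\Gamma$-converge, with respect to the weak-$*$ convergence of sequences in $L^\infty(I,\mathbb R^2)$, to $$E(u)=\begin{cases}\int_I f_{hom}(u(x))\,dx&\text{if }|u|\le1\text{ a.e. in } I,\\+\infty&\text{otherwise in }L^\infty(I,\mathbb R^2),\end{cases}$$ where the integral converges whenever $|u|\le 1$ a.e. Furthermore: (i) if $J_1\ge4$, then $f_{hom}(z)=-(J_1-1)$ for all $z\in B_1$; (ii) if $0<J_1\le4$, then for all $z\in B_1$ $$\frac{(J_1-4)^2}{8}|z|^2\le f_{hom}(z)+1+\frac{J_1^2}{8}\le\frac{(J_1-4)^2}{8}|z|,$$ and there is a convex nondecreasing function $h:[0,1]\to\mathbb R$ with $f_{hom}(z)=h(|z|)$ for all $z\in B_1$; (iii) if $0<J_1\le4$,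 then $\min E=E(0)=-\big(1+\frac{J_1^2}{8}\big)$. -/

import Mathlib

open MeasureTheory Filter Topology

noncomputable section

namespace SpinChain

/-- The plane `ℝ²` with its Euclidean norm and scalar product. -/
abbrev Plane : Type := EuclideanSpace ℝ (Fin 2)

/-- The unit circle `S¹ ⊂ ℝ²`. -/
abbrev Circle1 : Type := Metric.sphere (0 : Plane) 1

/-- Lebesgue measure on the interval `I = (0,1)`. -/
abbrev volI : Measure ℝ := volume.restrict (Set.Ioo (0 : ℝ) 1)

/-- The space `L^∞(I, ℝ²)`. -/
abbrev LInfI : Type := Lp Plane ⊤ volI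

/-- A spin configuration on the lattice points `0, 1, …, N`. It is given as a function on `ℕ`; only
its values at `0, …, N` enter the notions below. -/
abbrev Spins : Type := ℕ → Circle1

/-- The boundary condition `(u¹, u⁰) = (u^N, u^{N-1})` on the lattice `{0, …, N}`. -/
def PeriodicBC (N : ℕ) (v : Spins) : Prop :=
  inner ℝ (v 1 : Plane) (v 0 : Plane) = inner ℝ (v N : Plane) (v (N - 1) : Plane)

/-- The unscaled energy of a chain on `{0, …, N}`:
`-J₁ ∑_{i=0}^{N-2} (uⁱ, u^{i+1}) + ∑_{i=0}^{N-2} (uⁱ, u^{i+2})`. -/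
def chainEnergy (J₁ : ℝ) (N : ℕ) (v : Spins) : ℝ :=
  -J₁ * ∑ i ∈ Finset.range (N - 1), inner ℝ (v i : Plane) (v (i + 1) : Plane)
    + ∑ i ∈ Finset.range (N - 1), inner ℝ (v i : Plane) (v (i + 2) : Plane)

/-- The piecewise constant interpolation of `v`, equal to `vⁱ` on the cell `lam (i + [0,1))`. -/
def interp (lam : ℝ) (v : Spins) (x : ℝ) : Plane := (v ⌊x / lam⌋₊ : Plane)

/-- The energy `E_n` on `L^∞(I, ℝ²)` for the lattice spacing `lam = λ_n`, with `N = [1/λ_n]`: it is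
`λ_n * chainEnergy J₁ N v` if `u` is (a.e.) the interpolation of a configuration `v` that satisfies
the boundary condition, and `+∞` (an infimum over the empty set) if there is no such `v`.
The values `v⁰, …, v^N` are determined by `u`, with the exception of `v^N` when `lam * N = 1`,
because the last cell does not meet `I` in that case; the infimum is then over the possible `v^N`. -/
def energy (J₁ lam : ℝ) (u : LInfI) : EReal :=
  ⨅ (v : Spins) (_ : PeriodicBC ⌊1 / lam⌋₊ v) (_ : (u : ℝ → Plane) =ᵐ[volI] interp lam v),
    ((lam * chainEnergy J₁ ⌊1 / lam⌋₊ v : ℝ) : EReal)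

/-- The discrete average of `v` over `ℤ ∩ (0,k) = {1, …, k-1}`. -/
def average (k : ℕ) (v : Spins) : Plane :=
  ((Finset.Ioo 0 k).card : ℝ)⁻¹ • ∑ i ∈ Finset.Ioo 0 k, (v i : Plane)

/-- The minimum problem of the homogenization formula on `(0,k)`: `1/k` times the infimum of the
chain energy over the configurations on `{0, …, k}` with the boundary condition and with average in
the closed ball `B(z,ρ)` (`+∞` if there are none). -/
def cellInf (J₁ : ℝ) (z : Plane) (ρ : ℝ) (k : ℕ) : EReal :=
  ⨅ (v : Spins) (_ : PeriodicBC k v) (_ : average k v ∈ Metric.closedBall z ρ),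
    ((chainEnergy J₁ k v / k : ℝ) : EReal)

/-- `c = lim_{ρ → 0⁺} lim_{k → ∞} cellInf J₁ z ρ k`, where all the limits exist and are finite. -/
def IsHomLimit (J₁ : ℝ) (z : Plane) (c : ℝ) : Prop :=
  ∃ g : ℝ → ℝ,
    (∀ ρ : ℝ, 0 < ρ → Tendsto (fun k : ℕ => cellInf J₁ z ρ k) atTop (𝓝 ((g ρ : ℝ) : EReal))) ∧
      Tendsto g (𝓝[>] 0) (𝓝 c)

/-- Weak-* convergence in `L^∞(I, ℝ²)`, as the dual of `L¹(I, ℝ²)`. -/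
def WeakStarTendsto (u : ℕ → LInfI) (w : LInfI) : Prop :=
  ∀ g : ℝ → Plane, Integrable g volI →
    Tendsto (fun n => ∫ x, inner ℝ (u n x) (g x) ∂volI) atTop (𝓝 (∫ x, inner ℝ (w x) (g x) ∂volI))

/-- `F` is the `Γ`-limit of the functionals `Fn` with respect to weak-* convergence in
`L^∞(I, ℝ²)`: the liminf inequality along every converging sequence, and for every point the
existence of a recovery sequence. -/
def IsGammaLimit (Fn : ℕ → LInfI → EReal) (F : LInfI → EReal) : Prop :=
  (∀ (w : LInfI) (u : ℕ → LInfI), WeakStarTendsto u w →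
      F w ≤ liminf (fun n => Fn n (u n)) atTop) ∧
    ∀ w : LInfI, ∃ u : ℕ → LInfI, WeakStarTendsto u w ∧
      limsup (fun n => Fn n (u n)) atTop ≤ F w

open Classical in
/-- The functional `u ↦ ∫_I f(u(x)) dx` if `|u| ≤ 1` a.e., and `+∞` otherwise. -/
def bulkEnergy (f : Plane → ℝ) (u : LInfI) : EReal :=
  if ∀ᵐ x ∂volI, ‖u x‖ ≤ 1 then ((∫ x, f (u x) ∂volI : ℝ) : EReal) else ⊤

end SpinChain

end

noncomputable section

namespace SpinChain

/-! Cutting a chain, or gluing two chains, changes the energy by a bounded amount, so only the pairs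
(mean spin, energy per site) of long free chains matter. Once `interfaceCost` is charged to every
chain, energy is subadditive under concatenation (`realizable_add`). The pairs are therefore stable
under rational mixtures and their closure `epi` is convex (`convex_epi`). It is the epigraph of
`homDensity` on the unit ball, which is thus convex and lower semicontinuous. Every finite chain
lies above this density up to O(1) (`homDensity_mean_le`), and each point of `epi` is approximated
by chains of every large length (`exists_block`). The boundary condition costs O(1), since changing
the last spin enforces it.

These two facts give the homogenization formula: for fixed ρ the limit in k is the infimum of the
density over the part of the unit ball within ρ of z, and lower semicontinuity handles ρ → 0.

For the Γ-liminf, I is cut into M equal cells. Weak-* convergence makes the block means of the spins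
converge to the cell means of the limit, and only M interfaces are paid, a cost that vanishes with
the lattice spacing. Letting M → ∞ uses Lebesgue differentiation and Fatou
(`integral_homDensity_le`). For the Γ-limsup, Jensen's inequality in `epi` allows each cell to be
filled by a block whose mean is close to that of w and whose energy is close to that of w. The
primitives of the glued chain are uniformly close to those of w, which for bounded sequences yields
weak-* convergence.

The explicit bounds come from completing the square: up to boundary terms, the energy is half the
sum of |v_i - (J/2) v_{i+1} + v_{i+2}|² minus n(1 + J²/8). Jensen's inequality gives the quadratic
lower bound. A helix with cos φ = J/4 annihilates the squares and determines the value at 0, and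
convexity between 0 and the unit circle gives the linear upper bound. -/

/-- The energy of the two bonds that start at the lattice point `i`. -/
def bondEnergy (J : ℝ) (v : Spins) (i : ℕ) : ℝ :=
  -J * inner ℝ (v i : Plane) (v (i + 1) : Plane) + inner ℝ (v i : Plane) (v (i + 2) : Plane)

/-- The energy of the bonds that start at `0, …, n - 1`. -/
def partialEnergy (J : ℝ) (n : ℕ) (v : Spins) : ℝ := ∑ i ∈ Finset.range n, bondEnergy J v i

/-- The sum of the first `n` spins. -/
def spinSum (n : ℕ) (v : Spins) : Plane := ∑ i ∈ Finset.range n, (v i : Plane)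

/-- The configuration equal to `v` on `0, …, m - 1`, followed by `w`. -/
def concat (m : ℕ) (v w : Spins) : Spins := fun i => if i < m then v i else w (i - m)

/-- The configuration `v` read from the lattice point `s` on. -/
def shift (s : ℕ) (v : Spins) : Spins := fun i => v (s + i)

/-- A constant that dominates the energy of all the interactions across an interface. -/
def interfaceCost (J : ℝ) : ℝ := 10 * (J + 1) ^ 2

/-! ### Finite chains and the bounded cost of gluing -/

lemma chainEnergy_eq (J : ℝ) (N : ℕ) (v : Spins) :
    chainEnergy J N v = partialEnergy J (N - 1) v := by
  simp [chainEnergy, partialEnergy, bondEnergy, Finset.mul_sum, Finset.sum_add_distrib]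

lemma norm_spin (x : Circle1) : ‖(x : Plane)‖ = 1 := by
  simp

lemma abs_inner_spin_le (x y : Circle1) : |inner ℝ (x : Plane) (y : Plane)| ≤ 1 := by
  simpa [norm_spin] using abs_real_inner_le_norm (x : Plane) (y : Plane)

lemma abs_bondEnergy_le {J : ℝ} (hJ : 0 ≤ J) (v : Spins) (i : ℕ) :
    |bondEnergy J v i| ≤ J + 1 := by
  have h1 := abs_le.1 (abs_inner_spin_le (v i) (v (i + 1)))
  have h2 := abs_le.1 (abs_inner_spin_le (v i) (v (i + 2)))
  unfold bondEnergy
  rw [abs_le]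
  constructor <;> nlinarith

lemma partialEnergy_succ (J : ℝ) (n : ℕ) (v : Spins) :
    partialEnergy J (n + 1) v = partialEnergy J n v + bondEnergy J v n :=
  Finset.sum_range_succ _ _

lemma spinSum_succ (n : ℕ) (v : Spins) : spinSum (n + 1) v = spinSum n v + v n :=
  Finset.sum_range_succ _ _

lemma spinSum_add (m n : ℕ) (v : Spins) :
    spinSum (m + n) v = spinSum m v + spinSum n (shift m v) :=
  Finset.sum_range_add _ _ _

lemma partialEnergy_add (J : ℝ) (m n : ℕ) (v : Spins) :
    partialEnergy J (m + n) v = partialEnergy J m v + partialEnergy J n (shift m v) := by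
  simp only [partialEnergy, Finset.sum_range_add]
  rfl

lemma norm_spinSum_le (n : ℕ) (v : Spins) : ‖spinSum n v‖ ≤ n := by
  refine (norm_sum_le _ _).trans ?_
  simp

lemma abs_partialEnergy_le {J : ℝ} (hJ : 0 ≤ J) (n : ℕ) (v : Spins) :
    |partialEnergy J n v| ≤ n * (J + 1) := by
  refine (Finset.abs_sum_le_sum_abs _ _).trans ?_
  refine (Finset.sum_le_sum fun i _ => abs_bondEnergy_le hJ v i).trans ?_
  simp [mul_add]

lemma spinSum_congr {n : ℕ} {v w : Spins} (h : ∀ i < n, v i = w i) :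
    spinSum n v = spinSum n w :=
  Finset.sum_congr rfl fun i hi => by rw [h i (Finset.mem_range.1 hi)]

/-- Only the bonds that start at the last two sites see spins beyond n - 1, and each of these two
terms changes by at most 2(J + 1). -/
lemma abs_partialEnergy_sub_le {J : ℝ} (hJ : 0 ≤ J) {n : ℕ} {v w : Spins}
    (h : ∀ i < n, v i = w i) :
    |partialEnergy J n v - partialEnergy J n w| ≤ 4 * (J + 1) := by
  have key : ∀ k, k + 2 ≤ n → partialEnergy J k v = partialEnergy J k w := by
    intro k hk
    refine Finset.sum_congr rfl fun i hi => ?_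
    have hi := Finset.mem_range.1 hi
    simp only [bondEnergy]
    rw [h i (by omega), h (i + 1) (by omega), h (i + 2) (by omega)]
  have hv := fun i => abs_le.1 (abs_bondEnergy_le hJ v i)
  have hw := fun i => abs_le.1 (abs_bondEnergy_le hJ w i)
  match n with
  | 0 => simp [partialEnergy]; linarith
  | 1 =>
    rw [partialEnergy_succ, partialEnergy_succ]
    simp only [partialEnergy, Finset.range_zero, Finset.sum_empty, zero_add]
    rw [abs_le]
    constructor <;> linarith [hv 0, hw 0]
  | k + 2 =>
    simp only [partialEnergy_succ]
    rw [key k le_rfl, abs_le]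
    constructor <;> linarith [hv k, hw k, hv (k + 1), hw (k + 1)]

lemma concat_of_lt {m i : ℕ} (v w : Spins) (h : i < m) : concat m v w i = v i := if_pos h

lemma shift_concat (m : ℕ) (v w : Spins) : shift m (concat m v w) = w := by
  funext i
  simp [shift, concat]

lemma spinSum_concat (m n : ℕ) (v w : Spins) :
    spinSum (m + n) (concat m v w) = spinSum m v + spinSum n w := by
  rw [spinSum_add, shift_concat, spinSum_congr fun i hi => concat_of_lt v w hi]

lemma four_le_interfaceCost {J : ℝ} (hJ : 0 ≤ J) : 4 * (J + 1) ≤ interfaceCost J := by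
  unfold interfaceCost
  nlinarith

lemma partialEnergy_concat_le {J : ℝ} (hJ : 0 ≤ J) (m n : ℕ) (v w : Spins) :
    partialEnergy J (m + n) (concat m v w) ≤
      partialEnergy J m v + partialEnergy J n w + interfaceCost J := by
  have h := abs_le.1 (abs_partialEnergy_sub_le hJ (n := m) fun i hi => concat_of_lt v w hi)
  rw [partialEnergy_add, shift_concat]
  linarith [four_le_interfaceCost hJ]

/-! ### The epigraph of the homogenized density -/

/-- The triples (length, sum of the spins, upper bound of the energy, including the cost of an
interface) that are realized by a configuration. -/
def realizable (J : ℝ) : Set (ℕ × Plane × ℝ) :=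
  {p | ∃ v, spinSum p.1 v = p.2.1 ∧ partialEnergy J p.1 v + interfaceCost J ≤ p.2.2}

/-- One of the two interface costs pays for the junction and the other remains with the glued chain.
-/
lemma realizable_add {J : ℝ} (hJ : 0 ≤ J) {p q : ℕ × Plane × ℝ} (hp : p ∈ realizable J)
    (hq : q ∈ realizable J) : p + q ∈ realizable J := by
  obtain ⟨v, hv, hv'⟩ := hp
  obtain ⟨w, hw, hw'⟩ := hq
  refine ⟨concat p.1 v w, ?_, ?_⟩
  · simp [spinSum_concat, hv, hw]
  · have := partialEnergy_concat_le hJ p.1 q.1 v w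
    simp only [Prod.fst_add, Prod.snd_add]
    linarith

lemma realizable_nsmul {J : ℝ} (hJ : 0 ≤ J) {p : ℕ × Plane × ℝ} (hp : p ∈ realizable J)
    {k : ℕ} (hk : 0 < k) : k • p ∈ realizable J := by
  induction k, hk using Nat.le_induction with
  | base => simpa using hp
  | succ k _ ih => rw [succ_nsmul]; exact realizable_add hJ ih hp

/-- The pairs (mean spin, energy density) of finite configurations. -/
def densitySet (J : ℝ) : Set (Plane × ℝ) :=
  {p | ∃ n : ℕ, 0 < n ∧ (n, (n : ℝ) • p) ∈ realizable J}

/-- The closed epigraph of the homogenized energy density. -/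
def epi (J : ℝ) : Set (Plane × ℝ) := closure (densitySet J)

lemma isClosed_epi (J : ℝ) : IsClosed (epi J) := isClosed_closure

/-- Repeating a block of length m exactly a n times and a block of length n exactly b m times makes
the two occupied lengths have ratio a : b. -/
lemma densitySet_combo {J : ℝ} (hJ : 0 ≤ J) {p q : Plane × ℝ} (hp : p ∈ densitySet J)
    (hq : q ∈ densitySet J) {a b : ℕ} (ha : 0 < a) (hb : 0 < b) :
    ((a : ℝ) / (a + b)) • p + ((b : ℝ) / (a + b)) • q ∈ densitySet J := by
  obtain ⟨m, hm, hmp⟩ := hp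
  obtain ⟨n, hn, hnq⟩ := hq
  refine ⟨(a + b) * (m * n), by positivity, ?_⟩
  have h := realizable_add hJ (realizable_nsmul hJ hmp (Nat.mul_pos ha hn))
    (realizable_nsmul hJ hnq (Nat.mul_pos hb hm))
  have e : (a * n) • (m, (m : ℝ) • p) + (b * m) • (n, (n : ℝ) • q) =
      ((a + b) * (m * n), (((a + b) * (m * n) : ℕ) : ℝ) •
        (((a : ℝ) / (a + b)) • p + ((b : ℝ) / (a + b)) • q)) := by
    have hab : (a : ℝ) + b ≠ 0 := by positivity
    refine Prod.ext ?_ ?_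
    · simp; ring
    · simp only [Prod.snd_add, Prod.smul_snd, smul_add, smul_smul, ← Nat.cast_smul_eq_nsmul ℝ]
      congr 2 <;> · push_cast; field_simp
  rwa [e] at h

lemma convex_epi {J : ℝ} (hJ : 0 ≤ J) : Convex ℝ (epi J) := by
  rw [convex_iff_forall_pos]
  intro p hp q hq a b ha hb hab
  have key : ∀ x ∈ densitySet J, ∀ y ∈ densitySet J, a • x + b • y ∈ epi J := by
    intro x hx y hy
    -- Real weights are limits of ratios of integers. The `+ 1` keeps both multiplicities positive.
    have hA : Tendsto (fun n : ℕ => ((⌊a * n⌋₊ + 1 : ℕ) : ℝ) / n) atTop (𝓝 a) := by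
      have h1 := (tendsto_nat_floor_mul_div_atTop (R := ℝ) ha.le).comp tendsto_natCast_atTop_atTop
      have h2 := h1.add tendsto_one_div_atTop_nhds_zero_nat
      rw [add_zero] at h2
      refine h2.congr fun n => ?_
      simp [add_div]
    have hB : Tendsto (fun n : ℕ => ((⌊b * n⌋₊ + 1 : ℕ) : ℝ) / n) atTop (𝓝 b) := by
      have h1 := (tendsto_nat_floor_mul_div_atTop (R := ℝ) hb.le).comp tendsto_natCast_atTop_atTop
      have h2 := h1.add tendsto_one_div_atTop_nhds_zero_nat
      rw [add_zero] at h2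
      refine h2.congr fun n => ?_
      simp [add_div]
    have hAB := hA.add hB
    rw [hab] at hAB
    have h3 := (hA.div hAB one_ne_zero).smul_const x |>.add
      ((hB.div hAB one_ne_zero).smul_const y)
    rw [div_one, div_one] at h3
    refine mem_closure_of_tendsto h3 ?_
    filter_upwards [eventually_gt_atTop 0] with n hn
    have hn' : (n : ℝ) ≠ 0 := by positivity
    have := densitySet_combo hJ hx hy (Nat.succ_pos ⌊a * n⌋₊) (Nat.succ_pos ⌊b * n⌋₊)
    convert this using 3 <;>
    · simp only [Pi.div_apply, Nat.succ_eq_add_one]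
      field_simp
  have := map_mem_closure₂ (f := fun x y : Plane × ℝ => a • x + b • y) (by fun_prop) hp hq
    (u := epi J) key
  rwa [(isClosed_epi J).closure_eq] at this

/-- A closed property of `epi` needs checking only on finite configurations; the lower bounds on the
density are derived in this way. -/
lemma epi_induction {J : ℝ} {K : Set (Plane × ℝ)} (hK : IsClosed K)
    (h : ∀ n : ℕ, 0 < n → ∀ v t, partialEnergy J n v + interfaceCost J ≤ n * t →
      ((n : ℝ)⁻¹ • spinSum n v, t) ∈ K) : epi J ⊆ K := by
  refine closure_minimal ?_ hK
  rintro ⟨z, t⟩ ⟨n, hn, v, hv, hv'⟩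
  have := h n hn v t (by simpa using hv')
  have hn' : (n : ℝ) ≠ 0 := by positivity
  simp only [Prod.smul_mk, smul_eq_mul] at hv
  rwa [hv, smul_smul, inv_mul_cancel₀ hn', one_smul] at this

lemma mem_epi_of_partialEnergy_le {J : ℝ} {n : ℕ} (hn : 0 < n) {v : Spins} {t : ℝ}
    (h : partialEnergy J n v + interfaceCost J ≤ n * t) :
    ((n : ℝ)⁻¹ • spinSum n v, t) ∈ epi J := by
  refine subset_closure ⟨n, hn, v, ?_, ?_⟩
  · have hn' : (n : ℝ) ≠ 0 := by positivity
    simp only [Prod.smul_mk, smul_smul]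
    rw [mul_inv_cancel₀ hn', one_smul]
  · simpa using h

lemma epi_mono {J : ℝ} {z : Plane} {s t : ℝ} (h : (z, s) ∈ epi J) (hst : s ≤ t) :
    (z, t) ∈ epi J := by
  have hK : IsClosed ((fun p : Plane × ℝ => (p.1, p.2 + (t - s))) ⁻¹' epi J) :=
    (isClosed_epi J).preimage (by fun_prop)
  have := epi_induction hK (fun n hn v r hr => mem_epi_of_partialEnergy_le (t := r + (t - s)) hn
    (hr.trans (by gcongr; linarith))) h
  simpa using this

lemma neg_le_of_mem_epi {J : ℝ} (hJ : 0 ≤ J) {p : Plane × ℝ} (h : p ∈ epi J) :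
    -(J + 1) ≤ p.2 := by
  have hK : IsClosed {p : Plane × ℝ | -(J + 1) ≤ p.2} :=
    isClosed_le continuous_const continuous_snd
  refine epi_induction hK (fun n hn v t ht => ?_) h
  have h1 := abs_le.1 (abs_partialEnergy_le hJ n v)
  have h2 := four_le_interfaceCost hJ
  have hn' : (0 : ℝ) < n := by positivity
  have : (n : ℝ) * -(J + 1) ≤ n * t := by linarith
  exact le_of_mul_le_mul_left this hn'

/-- Constant configurations realize the unit vectors with energy density `1 - J`. -/
lemma mem_epi_of_norm_eq_one (J : ℝ) {e : Plane} (he : ‖e‖ = 1) : (e, 1 - J) ∈ epi J := by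
  let v : Spins := fun _ => ⟨e, by simpa using he⟩
  have hS : ∀ n : ℕ, spinSum n v = (n : ℝ) • e := by
    intro n
    simp [spinSum, v, Nat.cast_smul_eq_nsmul]
  have hW : ∀ n : ℕ, partialEnergy J n v = n * (1 - J) := by
    intro n
    simp [partialEnergy, bondEnergy, v, he]
    ring
  have h : Tendsto (fun n : ℕ => (e, 1 - J + interfaceCost J / n)) atTop (𝓝 (e, 1 - J)) := by
    have h := (tendsto_const_nhds (x := 1 - J)).add
      (tendsto_const_div_atTop_nhds_zero_nat (interfaceCost J))
    rw [add_zero] at h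
    exact tendsto_const_nhds.prodMk_nhds h
  refine (isClosed_epi J).mem_of_tendsto h ?_
  filter_upwards [eventually_gt_atTop 0] with n hn
  have hn' : (n : ℝ) ≠ 0 := by positivity
  have := mem_epi_of_partialEnergy_le (J := J) (v := v) (t := 1 - J + interfaceCost J / n) hn
    (by rw [hW, mul_add, mul_div_cancel₀ _ hn'])
  rwa [hS, smul_smul, inv_mul_cancel₀ hn', one_smul] at this

lemma exists_norm_one_smul (z : Plane) : ∃ e : Plane, ‖e‖ = 1 ∧ z = ‖z‖ • e := by
  by_cases hz : z = 0
  · exact ⟨EuclideanSpace.single 0 1, by simp, by simp [hz]⟩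
  · refine ⟨‖z‖⁻¹ • z, ?_, ?_⟩
    · rw [norm_smul, norm_inv, norm_norm, inv_mul_cancel₀ (norm_ne_zero_iff.2 hz)]
    · rw [smul_smul, mul_inv_cancel₀ (norm_ne_zero_iff.2 hz), one_smul]

/-- z is a convex combination of two opposite unit vectors, both realized by constant chains at the
same energy density. -/
lemma mem_epi_of_norm_le_one {J : ℝ} (hJ : 0 ≤ J) {z : Plane} (hz : ‖z‖ ≤ 1) :
    (z, 1 - J) ∈ epi J := by
  obtain ⟨e, he, hze⟩ := exists_norm_one_smul z
  have h := convex_epi hJ (mem_epi_of_norm_eq_one J he)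
    (mem_epi_of_norm_eq_one J (e := -e) (by simpa using he))
    (a := (1 + ‖z‖) / 2) (b := (1 - ‖z‖) / 2) (by positivity) (by linarith) (by ring)
  convert h using 1
  refine Prod.ext ?_ ?_
  · simp only [Prod.smul_mk, Prod.mk_add_mk, smul_neg, ← sub_eq_add_neg, ← sub_smul]
    nth_rewrite 1 [hze]
    congr 1; ring
  · simp; ring

/-- The homogenized energy density. -/
def homDensity (J : ℝ) (z : Plane) : ℝ := sInf {t | (z, t) ∈ epi J}

/-- The vertical slice of `epi` over z is closed, nonempty and bounded below, so its infimum is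
attained; it is also upward closed. -/
lemma homDensity_le_iff {J : ℝ} (hJ : 0 ≤ J) {z : Plane} (hz : ‖z‖ ≤ 1) {t : ℝ} :
    homDensity J z ≤ t ↔ (z, t) ∈ epi J := by
  have hb : BddBelow {t | (z, t) ∈ epi J} := ⟨-(J + 1), fun t ht => neg_le_of_mem_epi hJ ht⟩
  have hc : IsClosed {t | (z, t) ∈ epi J} := (isClosed_epi J).preimage (by fun_prop)
  constructor
  · intro h
    exact epi_mono (hc.csInf_mem ⟨_, mem_epi_of_norm_le_one hJ hz⟩ hb) h
  · intro h
    exact csInf_le hb h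

lemma homDensity_mem_epi {J : ℝ} (hJ : 0 ≤ J) {z : Plane} (hz : ‖z‖ ≤ 1) :
    (z, homDensity J z) ∈ epi J := (homDensity_le_iff hJ hz).1 le_rfl

lemma homDensity_le {J : ℝ} (hJ : 0 ≤ J) {z : Plane} (hz : ‖z‖ ≤ 1) : homDensity J z ≤ 1 - J :=
  (homDensity_le_iff hJ hz).2 (mem_epi_of_norm_le_one hJ hz)

lemma neg_le_homDensity {J : ℝ} (hJ : 0 ≤ J) {z : Plane} (hz : ‖z‖ ≤ 1) :
    -(J + 1) ≤ homDensity J z :=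
  neg_le_of_mem_epi hJ (homDensity_mem_epi hJ hz)

lemma abs_homDensity_le {J : ℝ} (hJ : 0 ≤ J) {z : Plane} (hz : ‖z‖ ≤ 1) :
    |homDensity J z| ≤ J + 1 :=
  abs_le.2 ⟨neg_le_homDensity hJ hz, (homDensity_le hJ hz).trans (by linarith)⟩

lemma norm_mean_le (n : ℕ) (v : Spins) : ‖(n : ℝ)⁻¹ • spinSum n v‖ ≤ 1 := by
  rw [norm_smul, norm_inv, Real.norm_natCast]
  rcases Nat.eq_zero_or_pos n with rfl | hn
  · simp
  · have hn' : (0 : ℝ) < n := by positivity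
    rw [inv_mul_le_iff₀ hn', mul_one]
    exact norm_spinSum_le n v

/-- Each finite configuration has at least the energy predicted by the homogenized density. -/
lemma homDensity_mean_le {J : ℝ} (hJ : 0 ≤ J) (n : ℕ) (v : Spins) :
    n * homDensity J ((n : ℝ)⁻¹ • spinSum n v) ≤ partialEnergy J n v + interfaceCost J := by
  rcases Nat.eq_zero_or_pos n with rfl | hn
  · have := four_le_interfaceCost hJ
    simp only [partialEnergy, CharP.cast_eq_zero, zero_mul, Finset.range_zero, Finset.sum_empty]
    linarith
  · have hn' : (0 : ℝ) < n := by positivity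
    rw [← le_div_iff₀' hn', homDensity_le_iff hJ (norm_mean_le n v)]
    exact mem_epi_of_partialEnergy_le hn (by rw [mul_div_cancel₀ _ hn'.ne'])

lemma convexOn_homDensity {J : ℝ} (hJ : 0 ≤ J) :
    ConvexOn ℝ (Metric.closedBall (0 : Plane) 1) (homDensity J) := by
  refine ⟨convex_closedBall _ _, fun x hx y hy a b ha hb hab => ?_⟩
  have hxy := convex_closedBall (0 : Plane) 1 hx hy ha hb hab
  rw [mem_closedBall_zero_iff] at hx hy hxy
  rw [homDensity_le_iff hJ hxy]
  exact convex_epi hJ (homDensity_mem_epi hJ hx) (homDensity_mem_epi hJ hy) ha hb hab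

/-- Lower semicontinuity on the closed unit ball. -/
lemma eventually_lt_homDensity {J : ℝ} (hJ : 0 ≤ J) {ι : Type*} {l : Filter ι} {u : ι → Plane}
    {z : Plane} (hu : ∀ i, ‖u i‖ ≤ 1) (hz : ‖z‖ ≤ 1) (h : Tendsto u l (𝓝 z)) {t : ℝ}
    (ht : t < homDensity J z) : ∀ᶠ i in l, t < homDensity J (u i) := by
  have hK : IsOpen {y : Plane | (y, t) ∉ epi J} :=
    ((isClosed_epi J).preimage (f := fun y : Plane => (y, t)) (by fun_prop)).isOpen_compl
  have hz' : z ∈ {y : Plane | (y, t) ∉ epi J} := fun h => by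
    rw [← homDensity_le_iff hJ hz] at h
    linarith
  filter_upwards [h (hK.mem_nhds hz')] with i hi
  by_contra hlt
  exact hi ((homDensity_le_iff hJ (hu i)).1 (not_lt.1 hlt))

/-- Each point of the epigraph is nearly realized by the configurations of all large lengths. -/
lemma exists_block {J : ℝ} (hJ : 0 ≤ J) {z : Plane} {t : ℝ} (h : (z, t) ∈ epi J) {ε : ℝ}
    (hε : 0 < ε) : ∃ n₀ : ℕ, ∀ n ≥ n₀, ∃ v, ‖spinSum n v - (n : ℝ) • z‖ ≤ ε * n ∧
      partialEnergy J n v + interfaceCost J ≤ n * (t + ε) := by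
  obtain ⟨⟨z', t'⟩, ⟨m, hm, v, hv, hv'⟩, hd⟩ := Metric.mem_closure_iff.1 h (ε / 2) (by positivity)
  rw [Prod.dist_eq, max_lt_iff] at hd
  obtain ⟨hd1, hd2⟩ := hd
  simp only [Prod.smul_mk, smul_eq_mul] at hv hv'
  rw [dist_eq_norm] at hd1
  rw [Real.dist_eq, abs_lt] at hd2
  -- D collects the errors caused by the incomplete last block, in the spin sum and in the energy.
  set D := 2 * m + m * (J + 1) + m * |t'| + interfaceCost J with hD
  have hD0 : 0 ≤ interfaceCost J := by unfold interfaceCost; positivity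
  refine ⟨m + ⌈2 * D / ε⌉₊, fun n hn => ?_⟩
  have hnD : D ≤ ε / 2 * n := by
    have h1 : 2 * D / ε ≤ n := (Nat.le_ceil _).trans (by exact_mod_cast (by omega))
    rw [div_le_iff₀ hε] at h1
    linarith
  have hq : 0 < n / m := Nat.div_pos (by omega) hm
  have hr : n % m < m := Nat.mod_lt _ hm
  have hmem : (n % m, spinSum (n % m) v, partialEnergy J (n % m) v + interfaceCost J) ∈
      realizable J := ⟨v, rfl, le_rfl⟩
  -- The block v is repeated `n / m` times and followed by its first `n % m` spins; the bound n ≥ m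
  -- gives at least one full copy.
  obtain ⟨w, hw, hw'⟩ := realizable_add hJ (realizable_nsmul hJ
    (show (m, (m : ℝ) • z', (m : ℝ) * t') ∈ realizable J from ⟨v, hv, hv'⟩) hq) hmem
  have hn' : (n / m) * m + n % m = n := by rw [mul_comm]; exact Nat.div_add_mod n m
  simp only [Prod.fst_add, Prod.smul_fst, smul_eq_mul, Prod.snd_add, Prod.smul_snd, hn',
    ← Nat.cast_smul_eq_nsmul ℝ, smul_smul] at hw hw'
  have hnR : ((n / m : ℕ) : ℝ) * m = n - (n % m : ℕ) := by
    rw [eq_sub_iff_add_eq]; exact_mod_cast hn'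
  have hrR : ((n % m : ℕ) : ℝ) ≤ m := by exact_mod_cast hr.le
  rw [hnR] at hw
  rw [← mul_assoc, hnR] at hw'
  have hz1 : ‖z'‖ ≤ 1 := by
    have := norm_mean_le m v
    have hm' : (m : ℝ) ≠ 0 := by positivity
    rwa [hv, smul_smul, inv_mul_cancel₀ hm', one_smul] at this
  refine ⟨w, ?_, ?_⟩
  · have e : spinSum n w - (n : ℝ) • z =
        (n : ℝ) • (z' - z) - ((n % m : ℕ) : ℝ) • z' + spinSum (n % m) v := by
      rw [hw]; module
    rw [e]
    refine (norm_add_le _ _).trans ?_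
    have h1 := norm_sub_le ((n : ℝ) • (z' - z)) (((n % m : ℕ) : ℝ) • z')
    have h2 := norm_spinSum_le (n % m) v
    rw [norm_smul, norm_smul, Real.norm_natCast, Real.norm_natCast] at h1
    have h3 : (n : ℝ) * ‖z - z'‖ ≤ n * (ε / 2) := by gcongr
    rw [norm_sub_rev] at h3
    have h4 : ((n % m : ℕ) : ℝ) * ‖z'‖ ≤ m * 1 := by gcongr
    have h5 : 0 ≤ (m : ℝ) * (J + 1) + m * |t'| := by positivity
    linarith
  · have h1 := abs_le.1 (abs_partialEnergy_le hJ (n % m) v)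
    have h2 : ((n % m : ℕ) : ℝ) * (J + 1) ≤ m * (J + 1) := by gcongr
    have h3 : -(((n % m : ℕ) : ℝ) * t') ≤ m * |t'| := by
      calc _ ≤ |((n % m : ℕ) : ℝ) * t'| := neg_le_abs _
        _ = (n % m : ℕ) * |t'| := by rw [abs_mul, Nat.abs_cast]
        _ ≤ _ := by gcongr
    have h4 : (n : ℝ) * t' ≤ n * (t + ε / 2) := by gcongr; linarith
    have h5 : (0 : ℝ) ≤ m := by positivity
    linarith

/-! ### Completing the square and explicit bounds -/

/-- `-J` times the bonds between neighbours, distributed evenly over the triples of neighbours, and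
the boundary terms that this leaves. -/
lemma partialEnergy_eq_symm (J : ℝ) (n : ℕ) (v : Spins) :
    partialEnergy J n v = ∑ i ∈ Finset.range n,
        (-(J / 2) * (inner ℝ (v i : Plane) (v (i + 1) : Plane)
          + inner ℝ (v (i + 1) : Plane) (v (i + 2) : Plane))
          + inner ℝ (v i : Plane) (v (i + 2) : Plane))
      + J / 2 * (inner ℝ (v n : Plane) (v (n + 1) : Plane)
          - inner ℝ (v 0 : Plane) (v 1 : Plane)) := by
  induction n with
  | zero => simp [partialEnergy]
  | succ n ih =>
    rw [partialEnergy_succ, ih, Finset.sum_range_succ, bondEnergy]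
    ring

lemma abs_boundary_le {J : ℝ} (hJ : 0 ≤ J) (n : ℕ) (v : Spins) :
    |J / 2 * (inner ℝ (v n : Plane) (v (n + 1) : Plane)
          - inner ℝ (v 0 : Plane) (v 1 : Plane))| ≤ J := by
  have h1 := abs_le.1 (abs_inner_spin_le (v n) (v (n + 1)))
  have h2 := abs_le.1 (abs_inner_spin_le (v 0) (v 1))
  rw [abs_le]
  constructor <;> nlinarith

lemma norm_sq_triple (c : ℝ) (x y z : Circle1) :
    ‖(x : Plane) - c • (y : Plane) + z‖ ^ 2 =
      2 + c ^ 2 - 2 * c * (inner ℝ (x : Plane) (y : Plane) + inner ℝ (y : Plane) (z : Plane))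
        + 2 * inner ℝ (x : Plane) (z : Plane) := by
  rw [norm_add_sq_real, norm_sub_sq_real, inner_sub_left, real_inner_smul_left,
    real_inner_smul_right, norm_smul, norm_spin, norm_spin, norm_spin, mul_pow, Real.norm_eq_abs,
    sq_abs]
  ring

/-- The choice c = J/2 in `norm_sq_triple` matches the coefficients of the symmetrized energy. -/
lemma partialEnergy_eq_sum_sq (J : ℝ) (n : ℕ) (v : Spins) :
    partialEnergy J n v = 1 / 2 * (∑ i ∈ Finset.range n,
        ‖(v i : Plane) - (J / 2) • (v (i + 1) : Plane) + v (i + 2)‖ ^ 2) - n * (1 + J ^ 2 / 8)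
      + J / 2 * (inner ℝ (v n : Plane) (v (n + 1) : Plane)
          - inner ℝ (v 0 : Plane) (v 1 : Plane)) := by
  rw [partialEnergy_eq_symm, Finset.mul_sum]
  congr 1
  rw [eq_sub_iff_add_eq, ← nsmul_eq_mul, ← Finset.card_range n, ← Finset.sum_const,
    Finset.card_range, ← Finset.sum_add_distrib]
  refine Finset.sum_congr rfl fun i _ => ?_
  rw [norm_sq_triple]
  ring

/-- The three shifted sums agree with `spinSum` up to end terms, and their coefficients add up to 1
- J/2 + 1. -/
lemma exists_sum_triple_eq {J : ℝ} (hJ : 0 ≤ J) (n : ℕ) (v : Spins) :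
    ∃ r : Plane, ‖r‖ ≤ J + 4 ∧
      ∑ i ∈ Finset.range n, ((v i : Plane) - (J / 2) • (v (i + 1) : Plane) + v (i + 2)) =
        (2 - J / 2) • spinSum n v + r := by
  refine ⟨-(J / 2) • (v n - v 0 : Plane) + (v n + v (n + 1) - v 0 - v 1 : Plane), ?_, ?_⟩
  · refine (norm_add_le _ _).trans (add_le_add ?_ ?_)
    · have h := norm_sub_le (v n : Plane) (v 0)
      rw [norm_spin, norm_spin] at h
      rw [norm_smul, norm_neg, Real.norm_eq_abs, abs_of_nonneg (by positivity)]
      nlinarith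
    · have h1 := norm_sub_le (v n + v (n + 1) - v 0 : Plane) (v 1)
      have h2 := norm_sub_le (v n + v (n + 1) : Plane) (v 0)
      have h3 := norm_add_le (v n : Plane) (v (n + 1))
      simp only [norm_spin] at h1 h2 h3
      linarith
  · induction n with
    | zero => simp [spinSum]
    | succ n ih =>
      rw [Finset.sum_range_succ, ih, spinSum_succ]
      module

/-- The quadratic lower bound of the energy, by Jensen's inequality. -/
lemma quadratic_le_partialEnergy {J : ℝ} (hJ : 0 ≤ J) {n : ℕ} (hn : 0 < n) (v : Spins) :
    n * ((J - 4) ^ 2 / 8 * ‖(n : ℝ)⁻¹ • spinSum n v‖ ^ 2 - (1 + J ^ 2 / 8)) ≤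
      partialEnergy J n v + interfaceCost J := by
  obtain ⟨r, hr, hsum⟩ := exists_sum_triple_eq hJ n v
  have hb := abs_le.1 (abs_boundary_le hJ n v)
  rw [partialEnergy_eq_sum_sq]
  set Q := ∑ i ∈ Finset.range n,
    ‖(v i : Plane) - (J / 2) • (v (i + 1) : Plane) + v (i + 2)‖ ^ 2 with hQ
  have hn' : (0 : ℝ) < n := by positivity
  have h1 : ‖(2 - J / 2) • spinSum n v + r‖ ^ 2 ≤ n * Q := by
    rw [← hsum]
    calc _ ≤ (∑ i ∈ Finset.range n,
          ‖(v i : Plane) - (J / 2) • (v (i + 1) : Plane) + v (i + 2)‖) ^ 2 := by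
          gcongr; exact norm_sum_le _ _
      _ ≤ _ := by
          have := sq_sum_le_card_mul_sum_sq (s := Finset.range n)
            (f := fun i => ‖(v i : Plane) - (J / 2) • (v (i + 1) : Plane) + v (i + 2)‖)
          simpa using this
  set s := ‖spinSum n v‖ with hs
  have hsn : s ≤ n := norm_spinSum_le n v
  have hs0 : 0 ≤ s := norm_nonneg _
  set c := |2 - J / 2| with hc
  have hc0 : 0 ≤ c := abs_nonneg _
  have hc1 : c ≤ 2 + J / 2 := abs_le.2 ⟨by linarith, by linarith⟩
  have hc2 : c ^ 2 = (J - 4) ^ 2 / 4 := by rw [hc, sq_abs]; ring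
  have h2 : c * s - (J + 4) ≤ ‖(2 - J / 2) • spinSum n v + r‖ := by
    have := norm_sub_le ((2 - J / 2) • spinSum n v + r) r
    rw [add_sub_cancel_right, norm_smul, Real.norm_eq_abs] at this
    linarith
  -- If c s ≤ J + 4 the left side is nonpositive; otherwise both sides of `h2` may be squared.
  have h3 : (c * s) ^ 2 - 2 * (c * s) * (J + 4) ≤ ‖(2 - J / 2) • spinSum n v + r‖ ^ 2 := by
    have h4 := norm_nonneg ((2 - J / 2) • spinSum n v + r)
    have h5 : 0 ≤ c * s := by positivity
    rcases le_total (c * s) (J + 4) with h | h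
    · nlinarith
    · nlinarith
  have h4 : c * s * (J + 4) ≤ n * ((2 + J / 2) * (J + 4)) := by
    calc _ ≤ (2 + J / 2) * n * (J + 4) := by gcongr
      _ = _ := by ring
  have h5 : (c * s) ^ 2 / n ≤ Q + 2 * ((2 + J / 2) * (J + 4)) := by
    rw [div_le_iff₀ hn']
    nlinarith
  have e : (n : ℝ) * ((J - 4) ^ 2 / 8 * ‖(n : ℝ)⁻¹ • spinSum n v‖ ^ 2 - (1 + J ^ 2 / 8)) =
      1 / 2 * ((c * s) ^ 2 / n) - n * (1 + J ^ 2 / 8) := by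
    rw [norm_smul, norm_inv, Real.norm_natCast, ← hs, mul_pow c, hc2]
    field_simp
    ring
  rw [e]
  -- The left side equals 8 at J = 0, which is why `interfaceCost` carries a factor as large as 10.
  have h6 : (2 + J / 2) * (J + 4) + J ≤ interfaceCost J := by
    unfold interfaceCost; nlinarith
  linarith

lemma quadratic_le_homDensity {J : ℝ} (hJ : 0 ≤ J) {z : Plane} (hz : ‖z‖ ≤ 1) :
    (J - 4) ^ 2 / 8 * ‖z‖ ^ 2 ≤ homDensity J z + (1 + J ^ 2 / 8) := by
  have hK : IsClosed {p : Plane × ℝ | (J - 4) ^ 2 / 8 * ‖p.1‖ ^ 2 - (1 + J ^ 2 / 8) ≤ p.2} :=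
    isClosed_le (by fun_prop) (by fun_prop)
  have h := epi_induction hK (fun n hn v t ht => ?_) (homDensity_mem_epi hJ hz)
  · simp only [Set.mem_ofPred_eq] at h
    linarith
  · exact le_of_mul_le_mul_left ((quadratic_le_partialEnergy hJ hn v).trans ht) (by positivity)

/-- For a triple x, y, z, |x - 2y + z|² ≥ 0 gives (x,z) ≥ 2((x,y) + (y,z)) - 3. The remaining
coefficient 2 - J/2 is nonpositive, so the aligned triple, of energy 1 - J, is optimal. -/
lemma ferromagnetic_le_partialEnergy {J : ℝ} (hJ : 4 ≤ J) (n : ℕ) (v : Spins) :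
    n * (1 - J) ≤ partialEnergy J n v + interfaceCost J := by
  have hb := abs_le.1 (abs_boundary_le (by linarith) n v)
  have h6 : J ≤ interfaceCost J := by unfold interfaceCost; nlinarith
  rw [partialEnergy_eq_symm]
  have : (n : ℝ) * (1 - J) ≤ ∑ i ∈ Finset.range n,
        (-(J / 2) * (inner ℝ (v i : Plane) (v (i + 1) : Plane)
          + inner ℝ (v (i + 1) : Plane) (v (i + 2) : Plane))
          + inner ℝ (v i : Plane) (v (i + 2) : Plane)) := by
    have := Finset.card_nsmul_le_sum (Finset.range n) (fun i =>
        (-(J / 2) * (inner ℝ (v i : Plane) (v (i + 1) : Plane)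
          + inner ℝ (v (i + 1) : Plane) (v (i + 2) : Plane))
          + inner ℝ (v i : Plane) (v (i + 2) : Plane))) (1 - J) (fun i _ => ?_)
    · simpa using this
    · have h := norm_sq_triple 2 (v i) (v (i + 1)) (v (i + 2))
      have h1 := abs_le.1 (abs_inner_spin_le (v i) (v (i + 1)))
      have h2 := abs_le.1 (abs_inner_spin_le (v (i + 1)) (v (i + 2)))
      nlinarith [sq_nonneg ‖(v i : Plane) - (2 : ℝ) • (v (i + 1) : Plane) + v (i + 2)‖]
  linarith

lemma homDensity_eq_of_four_le {J : ℝ} (hJ : 4 ≤ J) {z : Plane} (hz : ‖z‖ ≤ 1) :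
    homDensity J z = -(J - 1) := by
  have hJ0 : 0 ≤ J := by linarith
  refine le_antisymm ((homDensity_le hJ0 hz).trans (by linarith)) ?_
  have hK : IsClosed {p : Plane × ℝ | -(J - 1) ≤ p.2} :=
    isClosed_le (by fun_prop) (by fun_prop)
  refine epi_induction hK (fun n hn v t ht => ?_) (homDensity_mem_epi hJ0 hz)
  have := (ferromagnetic_le_partialEnergy hJ n v).trans ht
  have := le_of_mul_le_mul_left this (by positivity)
  simp only [Set.mem_ofPred_eq]
  linarith

/-- The configuration that turns by the angle `φ` from each lattice point to the next. -/
def helix (φ : ℝ) : Spins := fun i =>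
  ⟨!₂[Real.cos (i * φ), Real.sin (i * φ)], by
    simp [EuclideanSpace.norm_eq, Fin.sum_univ_two]⟩

lemma helix_triple (φ : ℝ) (i : ℕ) :
    (helix φ i : Plane) - (2 * Real.cos φ) • (helix φ (i + 1) : Plane) + helix φ (i + 2) = 0 := by
  have h1 : ((i : ℝ)) * φ = (i + 1) * φ - φ := by ring
  have h2 : ((i : ℝ) + 2) * φ = (i + 1) * φ + φ := by ring
  ext j
  fin_cases j
  · simp only [helix, Nat.cast_add, Nat.cast_one, Nat.cast_ofNat]
    rw [h1, h2]
    simp [Real.cos_add, Real.cos_sub]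
    ring
  · simp only [helix, Nat.cast_add, Nat.cast_one, Nat.cast_ofNat]
    rw [h1, h2]
    simp [Real.sin_add, Real.sin_sub]
    ring

/-- On the helix all squares vanish. The telescoped sum then reads (2 - J/2) `spinSum` = -r, so for
J < 4 the spin sums stay bounded and the mean tends to 0. At J = 4 this degenerates, and the bound 1
- J already suffices. -/
lemma homDensity_zero_le {J : ℝ} (hJ : 0 ≤ J) (hJ4 : J ≤ 4) :
    homDensity J 0 ≤ -(1 + J ^ 2 / 8) := by
  rcases hJ4.eq_or_lt with rfl | hlt
  · exact (homDensity_le hJ (by simp)).trans (by norm_num)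
  have hcos : 2 * Real.cos (Real.arccos (J / 4)) = J / 2 := by
    rw [Real.cos_arccos (by linarith) (by linarith)]; ring
  set v := helix (Real.arccos (J / 4))
  have hv : ∀ i, (v i : Plane) - (J / 2) • (v (i + 1) : Plane) + v (i + 2) = 0 := fun i => by
    rw [← hcos]; exact helix_triple _ i
  rw [homDensity_le_iff hJ (by simp)]
  have hS : ∀ n, ‖spinSum n v‖ ≤ (J + 4) / (2 - J / 2) := fun n => by
    obtain ⟨r, hr, hsum⟩ := exists_sum_triple_eq hJ n v
    simp only [hv, Finset.sum_const_zero] at hsum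
    have hpos : 0 < 2 - J / 2 := by linarith
    rw [le_div_iff₀' hpos]
    have := norm_smul (2 - J / 2) (spinSum n v)
    rw [eq_neg_of_add_eq_zero_left hsum.symm, norm_neg, Real.norm_eq_abs, abs_of_pos hpos] at this
    linarith
  have hlim : Tendsto (fun n : ℕ => ((n : ℝ)⁻¹ • spinSum n v,
      -(1 + J ^ 2 / 8) + (J + interfaceCost J) / n)) atTop (𝓝 (0, -(1 + J ^ 2 / 8))) := by
    refine Tendsto.prodMk_nhds ?_ ?_
    · refine squeeze_zero_norm (a := fun n : ℕ => (J + 4) / (2 - J / 2) / n) (fun n => ?_)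
        (tendsto_const_div_atTop_nhds_zero_nat _)
      rw [norm_smul, norm_inv, Real.norm_natCast, div_eq_inv_mul _ (n : ℝ)]
      gcongr
      exact hS n
    · have h := (tendsto_const_nhds (x := -(1 + J ^ 2 / 8))).add
        (tendsto_const_div_atTop_nhds_zero_nat (J + interfaceCost J))
      rwa [add_zero] at h
  refine (isClosed_epi J).mem_of_tendsto hlim ?_
  filter_upwards [eventually_gt_atTop 0] with n hn
  refine mem_epi_of_partialEnergy_le hn ?_
  have hn' : (n : ℝ) ≠ 0 := by positivity
  have hb := abs_le.1 (abs_boundary_le hJ n v)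
  rw [mul_add, mul_div_cancel₀ _ hn', partialEnergy_eq_sum_sq]
  simp only [hv, norm_zero, ne_eq, OfNat.ofNat_ne_zero, not_false_eq_true, zero_pow,
    Finset.sum_const_zero]
  linarith

lemma homDensity_zero {J : ℝ} (hJ : 0 ≤ J) (hJ4 : J ≤ 4) :
    homDensity J 0 = -(1 + J ^ 2 / 8) := by
  refine le_antisymm (homDensity_zero_le hJ hJ4) ?_
  have := quadratic_le_homDensity hJ (z := 0) (by simp)
  simp at this
  linarith

/-- Convexity on the segment from 0 to z/|z|, together with 1 - J + 1 + J²/8 = (J - 4)²/8. -/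
lemma homDensity_le_linear {J : ℝ} (hJ : 0 ≤ J) (hJ4 : J ≤ 4) {z : Plane} (hz : ‖z‖ ≤ 1) :
    homDensity J z + (1 + J ^ 2 / 8) ≤ (J - 4) ^ 2 / 8 * ‖z‖ := by
  obtain ⟨e, he, hze⟩ := exists_norm_one_smul z
  have h := (convexOn_homDensity hJ).2 (x := e) (by simp [he]) (y := 0) (by simp)
    (norm_nonneg z) (sub_nonneg.2 hz) (by ring)
  rw [smul_zero, add_zero, ← hze, homDensity_zero hJ hJ4, smul_eq_mul, smul_eq_mul] at h
  have := mul_le_mul_of_nonneg_left (homDensity_le hJ he.le) (norm_nonneg z)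
  nlinarith

/-- The image of a configuration under an isometry of the plane. -/
def mapSpins (R : Plane ≃ₗᵢ[ℝ] Plane) (v : Spins) : Spins := fun i =>
  ⟨R (v i), by simp⟩

lemma mem_epi_map (J : ℝ) (R : Plane ≃ₗᵢ[ℝ] Plane) {z : Plane} {t : ℝ} (h : (z, t) ∈ epi J) :
    (R z, t) ∈ epi J := by
  have hK : IsClosed ((fun p : Plane × ℝ => (R p.1, p.2)) ⁻¹' epi J) :=
    (isClosed_epi J).preimage ((R.continuous.comp continuous_fst).prodMk continuous_snd)
  refine epi_induction hK (fun n hn v s hs => ?_) h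
  have h1 : partialEnergy J n (mapSpins R v) = partialEnergy J n v := by
    simp [partialEnergy, bondEnergy, mapSpins]
  have h2 : spinSum n (mapSpins R v) = R (spinSum n v) := by
    simp [spinSum, mapSpins]
  have := mem_epi_of_partialEnergy_le hn (h1.symm ▸ hs)
  rw [h2] at this
  simpa using this

/-- Isometries preserve the energy, and for vectors of equal norm the reflection in the line
orthogonal to x - y carries x to y. -/
lemma homDensity_eq_of_norm_eq {J : ℝ} {z w : Plane} (h : ‖z‖ = ‖w‖) :
    homDensity J z = homDensity J w := by
  have key : ∀ {x y : Plane}, ‖x‖ = ‖y‖ → ∀ {t}, (x, t) ∈ epi J → (y, t) ∈ epi J := by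
    intro x y hxy t ht
    have := mem_epi_map J (Submodule.reflection (ℝ ∙ (x - y))ᗮ) ht
    rwa [Submodule.reflection_sub hxy] at this
  unfold homDensity
  congr 1
  ext t
  exact ⟨key h, key h.symm⟩

lemma exists_radial {J : ℝ} (hJ : 0 ≤ J) :
    ∃ h : ℝ → ℝ, ConvexOn ℝ (Set.Icc 0 1) h ∧ MonotoneOn h (Set.Icc 0 1) ∧
      ∀ z ∈ Metric.closedBall (0 : Plane) 1, homDensity J z = h ‖z‖ := by
  let e : Plane := EuclideanSpace.single 0 1
  have he : ‖e‖ = 1 := by simp [e]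
  have hne : ∀ r : ℝ, ‖r • e‖ = |r| := fun r => by rw [norm_smul, he, mul_one, Real.norm_eq_abs]
  have hcv : ConvexOn ℝ (Set.Icc (-1) 1) fun r : ℝ => homDensity J (r • e) := by
    have h := (convexOn_homDensity hJ).comp_linearMap (LinearMap.toSpanSingleton ℝ Plane e)
    refine h.subset (fun r hr => ?_) (convex_Icc _ _)
    simpa [hne, abs_le] using hr
  refine ⟨fun r => homDensity J (r • e), hcv.subset (Set.Icc_subset_Icc (by norm_num) le_rfl)
    (convex_Icc _ _), ?_, ?_⟩
  -- An even convex function is nondecreasing on the positive side, because a lies between -b and b.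
  · intro a ha b hb hab
    have hseg : a ∈ segment ℝ (-b) b := by
      rw [segment_eq_Icc (by linarith [hb.1])]
      exact ⟨by linarith [ha.1, hb.1], hab⟩
    have h := hcv.le_on_segment (x := -b) (y := b) ⟨by linarith [hb.2], by linarith [hb.1]⟩
      ⟨by linarith [hb.1], hb.2⟩ hseg
    have hs : homDensity J ((-b) • e) = homDensity J (b • e) :=
      homDensity_eq_of_norm_eq (by rw [hne, hne, abs_neg])
    rwa [hs, max_self] at h
  · intro z hz
    exact homDensity_eq_of_norm_eq (by rw [hne, abs_norm])

/-! ### The boundary condition and the homogenization formula -/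

lemma exists_inner_eq (a : Circle1) {c : ℝ} (hc : |c| ≤ 1) :
    ∃ b : Circle1, inner ℝ (b : Plane) (a : Plane) = c := by
  have ha := norm_spin a
  rw [EuclideanSpace.norm_eq, Real.sqrt_eq_one, Fin.sum_univ_two] at ha
  simp only [Real.norm_eq_abs, sq_abs] at ha
  have hs : Real.sqrt (1 - c ^ 2) ^ 2 = 1 - c ^ 2 :=
    Real.sq_sqrt (by nlinarith [abs_le.1 hc])
  set s := Real.sqrt (1 - c ^ 2)
  set x := (a : Plane) 0
  set y := (a : Plane) 1
  -- This is a rotated by an angle with cosine c and sine s.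
  refine ⟨⟨!₂[c * x - s * y, c * y + s * x], ?_⟩, ?_⟩
  · rw [mem_sphere_zero_iff_norm, EuclideanSpace.norm_eq, Real.sqrt_eq_one, Fin.sum_univ_two]
    simp only [Real.norm_eq_abs, sq_abs]
    simp
    linear_combination (c ^ 2 + s ^ 2) * ha + hs
  · simp [PiLp.inner_apply, Fin.sum_univ_two]
    linear_combination c * ha

/-- The boundary condition can be met by a change of the last spin. -/
lemma exists_periodicBC {N : ℕ} (hN : 2 ≤ N) (v : Spins) :
    ∃ w, PeriodicBC N w ∧ ∀ i, i ≠ N → w i = v i := by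
  obtain ⟨b, hb⟩ := exists_inner_eq (v (N - 1)) (abs_inner_spin_le (v 1) (v 0))
  refine ⟨Function.update v N b, ?_, fun i hi => Function.update_of_ne hi _ _⟩
  unfold PeriodicBC
  rw [Function.update_self, Function.update_of_ne (by omega), Function.update_of_ne (by omega),
    Function.update_of_ne (by omega), hb]

lemma chainEnergy_le_of_eq {J : ℝ} (hJ : 0 ≤ J) {N : ℕ} {v w : Spins}
    (h : ∀ i, i ≠ N → w i = v i) :
    chainEnergy J N w ≤ partialEnergy J (N - 1) v + 4 * (J + 1) := by
  rw [chainEnergy_eq]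
  have := abs_le.1 (abs_partialEnergy_sub_le hJ (n := N - 1) (v := w) (w := v)
    fun i hi => h i (by omega))
  linarith

lemma average_eq (k : ℕ) (v : Spins) :
    average k v = ((k - 1 : ℕ) : ℝ)⁻¹ • spinSum (k - 1) (shift 1 v) := by
  have : Finset.Ioo 0 k = Finset.Ico 1 k := by ext; simp; omega
  simp [average, this, Finset.sum_Ico_eq_sum_range, spinSum, shift]

/-- Sliding the window by one site drops one bond term and gains another. This is needed because
averages start at site 1 and energies at site 0. -/
lemma abs_partialEnergy_shift_one_sub_le {J : ℝ} (hJ : 0 ≤ J) (n : ℕ) (v : Spins) :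
    |partialEnergy J n (shift 1 v) - partialEnergy J n v| ≤ 2 * (J + 1) := by
  have h1 := partialEnergy_add J 1 n v
  rw [add_comm 1 n, partialEnergy_succ] at h1
  have h2 := abs_le.1 (abs_bondEnergy_le hJ v n)
  have h3 := abs_le.1 (abs_partialEnergy_le hJ 1 v)
  rw [abs_le]
  push_cast at h3
  constructor <;> linarith

lemma tendsto_pred_mul_add_div (a b : ℝ) :
    Tendsto (fun k : ℕ => (((k - 1 : ℕ) : ℝ) * a + b) / k) atTop (𝓝 a) := by
  have h := (tendsto_const_nhds (x := a)).add (tendsto_const_div_atTop_nhds_zero_nat (b - a))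
  rw [add_zero] at h
  refine h.congr' ?_
  filter_upwards [eventually_gt_atTop 0] with k hk
  have hk' : (k : ℝ) ≠ 0 := by positivity
  rw [Nat.cast_pred hk]
  field_simp
  ring

lemma le_cellInf {J : ℝ} (hJ : 0 ≤ J) {z : Plane} {ρ g : ℝ}
    (hg : ∀ w ∈ Metric.closedBall z ρ ∩ Metric.closedBall 0 1, g ≤ homDensity J w) (k : ℕ) :
    (((((k - 1 : ℕ) : ℝ) * g + -(interfaceCost J + 2 * (J + 1))) / k : ℝ) : EReal) ≤
      cellInf J z ρ k := by
  refine le_iInf fun v => le_iInf fun _ => le_iInf fun hv => ?_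
  rw [EReal.coe_le_coe_iff]
  gcongr
  rw [chainEnergy_eq]
  rw [average_eq] at hv
  have h1 := hg _ ⟨hv, mem_closedBall_zero_iff.2 (norm_mean_le _ _)⟩
  have h2 := homDensity_mean_le hJ (k - 1) (shift 1 v)
  have h3 := abs_le.1 (abs_partialEnergy_shift_one_sub_le hJ (k - 1) v)
  have h4 := mul_le_mul_of_nonneg_left h1 (Nat.cast_nonneg (α := ℝ) (k - 1))
  linarith

lemma eventually_cellInf_le {J : ℝ} (hJ : 0 ≤ J) {z w : Plane} {ρ ε : ℝ} (hw : ‖w‖ ≤ 1)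
    (hε : 0 < ε) (hwz : ‖w - z‖ + ε ≤ ρ) : ∀ᶠ k in atTop,
      cellInf J z ρ k ≤ (((((k - 1 : ℕ) : ℝ) * (homDensity J w + ε) + 6 * (J + 1)) / k : ℝ) :
        EReal) := by
  obtain ⟨n₀, hn₀⟩ := exists_block hJ (homDensity_mem_epi hJ hw) hε
  filter_upwards [eventually_ge_atTop (n₀ + 2)] with k hk
  obtain ⟨v, hv, hv'⟩ := hn₀ (k - 1) (by omega)
  -- The average sees only sites 1 to k - 1, so site 0 takes an arbitrary spin and site k can be
  -- altered for the boundary condition.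
  obtain ⟨u, hu, huv⟩ := exists_periodicBC (N := k) (by omega) (concat 1 v v)
  have hav : average k u = ((k - 1 : ℕ) : ℝ)⁻¹ • spinSum (k - 1) v := by
    rw [average_eq, ← shift_concat 1 v v]
    congr 1
    exact spinSum_congr fun i hi => huv (1 + i) (by omega)
  have hpos : (0 : ℝ) < (k - 1 : ℕ) := by exact_mod_cast (by omega : 0 < k - 1)
  refine iInf_le_of_le u (iInf_le_of_le hu (iInf_le_of_le ?_ ?_))
  · rw [hav, mem_closedBall_iff_norm]
    have e : ((k - 1 : ℕ) : ℝ)⁻¹ • spinSum (k - 1) v - z =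
        ((k - 1 : ℕ) : ℝ)⁻¹ • (spinSum (k - 1) v - ((k - 1 : ℕ) : ℝ) • w) + (w - z) := by
      rw [smul_sub, smul_smul, inv_mul_cancel₀ hpos.ne', one_smul]
      abel
    rw [e]
    refine (norm_add_le _ _).trans ?_
    have : ‖((k - 1 : ℕ) : ℝ)⁻¹ • (spinSum (k - 1) v - ((k - 1 : ℕ) : ℝ) • w)‖ ≤ ε := by
      rw [norm_smul, norm_inv, Real.norm_natCast, inv_mul_le_iff₀ hpos, mul_comm]
      exact hv
    linarith
  · rw [EReal.coe_le_coe_iff]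
    gcongr
    have h1 := chainEnergy_le_of_eq hJ huv
    have h2 := abs_le.1 (abs_partialEnergy_shift_one_sub_le hJ (k - 1) (concat 1 v v))
    rw [shift_concat] at h2
    have h3 := four_le_interfaceCost hJ
    linarith

lemma isHomLimit_homDensity {J : ℝ} (hJ : 0 ≤ J) {z : Plane} (hz : ‖z‖ ≤ 1) :
    IsHomLimit J z (homDensity J z) := by
  have hz' : z ∈ Metric.closedBall (0 : Plane) 1 := mem_closedBall_zero_iff.2 hz
  set A : ℝ → Set Plane := fun ρ => Metric.closedBall z ρ ∩ Metric.closedBall 0 1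
  have hzA : ∀ {ρ : ℝ}, 0 < ρ → z ∈ A ρ := fun h => ⟨Metric.mem_closedBall_self h.le, hz'⟩
  have hbdd : ∀ ρ, BddBelow (homDensity J '' A ρ) := by
    refine fun ρ => ⟨-(J + 1), ?_⟩
    rintro _ ⟨w, hw, rfl⟩
    exact neg_le_homDensity hJ (mem_closedBall_zero_iff.1 hw.2)
  refine ⟨fun ρ => sInf (homDensity J '' A ρ), fun ρ hρ => ?_, ?_⟩
  · rw [tendsto_order]
    refine ⟨fun a ha => ?_, fun a ha => ?_⟩
    · have hlow := le_cellInf hJ (z := z) (ρ := ρ) (g := sInf (homDensity J '' A ρ))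
        fun w hw => csInf_le (hbdd ρ) ⟨w, hw, rfl⟩
      have hlim := (continuous_coe_real_ereal.tendsto _).comp (tendsto_pred_mul_add_div
        (sInf (homDensity J '' A ρ)) (-(interfaceCost J + 2 * (J + 1))))
      filter_upwards [hlim.eventually_const_lt ha] with k hk
      exact lt_of_lt_of_le hk (hlow k)
    · obtain ⟨r, hr1, hr2⟩ := EReal.lt_iff_exists_real_btwn.1 ha
      rw [EReal.coe_lt_coe_iff] at hr1
      obtain ⟨_, ⟨w, hw, rfl⟩, hwr⟩ := exists_lt_of_csInf_lt
        (Set.Nonempty.image _ ⟨z, hzA hρ⟩) hr1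
      have hw1 := mem_closedBall_zero_iff.1 hw.2
      -- The near-minimizer w may lie on the boundary of the ball around z. Moving it slightly
      -- towards z leaves room for the approximation error, and convexity controls the density.
      obtain ⟨s, hs0, hs1, hs⟩ : ∃ s : ℝ, 0 < s ∧ s ≤ 1 ∧
          (1 - s) * homDensity J w + s * homDensity J z < r := by
        have hc : Tendsto (fun s : ℝ => (1 - s) * homDensity J w + s * homDensity J z)
            (𝓝[>] 0) (𝓝 (homDensity J w)) := by
          have : Continuous fun s : ℝ => (1 - s) * homDensity J w + s * homDensity J z := by
            fun_prop
          simpa using (this.tendsto 0).mono_left nhdsWithin_le_nhds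
        obtain ⟨s, h1, h2⟩ := ((hc.eventually_lt_const hwr).and
          (Ioc_mem_nhdsGT one_pos)).exists
        exact ⟨s, h2.1, h2.2, h1⟩
      set y := (1 - s) • w + s • z
      have hy : ‖y‖ ≤ 1 := mem_closedBall_zero_iff.1
        (convex_closedBall (0 : Plane) 1 hw.2 hz' (sub_nonneg.2 hs1) hs0.le (by ring))
      have hfy : homDensity J y < r := ((convexOn_homDensity hJ).2 hw.2 hz' (sub_nonneg.2 hs1)
        hs0.le (by ring)).trans_lt (by simpa using hs)
      have hyz : ‖y - z‖ ≤ (1 - s) * ρ := by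
        have : y - z = (1 - s) • (w - z) := by simp only [y]; module
        rw [this, norm_smul, Real.norm_of_nonneg (sub_nonneg.2 hs1)]
        have := mem_closedBall_iff_norm.1 hw.1
        gcongr
      set ε := min (s * ρ) ((r - homDensity J y) / 2)
      have hε : 0 < ε := lt_min (by positivity) (by linarith)
      have hε1 : ε ≤ s * ρ := min_le_left _ _
      have hε2 : ε ≤ (r - homDensity J y) / 2 := min_le_right _ _
      have hlim := tendsto_pred_mul_add_div (homDensity J y + ε) (6 * (J + 1))
      filter_upwards [eventually_cellInf_le hJ hy hε (z := z) (ρ := ρ) (by linarith),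
        hlim.eventually_lt_const (show homDensity J y + ε < r by linarith)] with k h1 h2
      exact h1.trans_lt (lt_trans (EReal.coe_lt_coe_iff.2 h2) hr2)
  · rw [tendsto_order]
    refine ⟨fun a ha => ?_, fun a ha => ?_⟩
    · obtain ⟨b, hab, hb⟩ := exists_between ha
      have hK : IsOpen {y : Plane | (y, b) ∉ epi J} :=
        ((isClosed_epi J).preimage (f := fun y : Plane => (y, b)) (by fun_prop)).isOpen_compl
      have hzK : z ∈ {y : Plane | (y, b) ∉ epi J} := fun h => by
        rw [← homDensity_le_iff hJ hz] at h
        linarith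
      obtain ⟨δ, hδ, hδK⟩ := Metric.isOpen_iff.1 hK z hzK
      filter_upwards [Ioo_mem_nhdsGT hδ] with ρ hρ
      refine hab.trans_le (le_csInf ⟨_, z, hzA hρ.1, rfl⟩ ?_)
      rintro _ ⟨w, hw, rfl⟩
      by_contra hlt
      exact hδK (Metric.closedBall_subset_ball hρ.2 hw.1)
        ((homDensity_le_iff hJ (mem_closedBall_zero_iff.1 hw.2)).1 (not_le.1 hlt).le)
    · filter_upwards [self_mem_nhdsWithin] with ρ hρ
      exact (csInf_le (hbdd ρ) ⟨z, hzA hρ, rfl⟩).trans_lt ha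

/-! ### Interpolations and weak-* convergence through primitives -/

lemma floor_div_eq {lam : ℝ} (hlam : 0 < lam) {s : ℕ} {x : ℝ}
    (hx : x ∈ Set.Ico (lam * s) (lam * (s + 1))) : ⌊x / lam⌋₊ = s := by
  rw [Nat.floor_eq_iff (div_nonneg ((by positivity : 0 ≤ lam * s).trans hx.1) hlam.le),
    le_div_iff₀ hlam, div_lt_iff₀ hlam]
  exact ⟨by linarith [hx.1], by linarith [hx.2]⟩

lemma step_ae_eq {E : Type*} {lam : ℝ} (hlam : 0 < lam) (g : ℕ → E) (s : ℕ) :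
    ∀ᵐ x, x ∈ Set.uIoc (lam * s) (lam * (s + 1)) → g ⌊x / lam⌋₊ = g s := by
  have h0 : ∀ᵐ x : ℝ, x ≠ lam * (s + 1) := by simp [ae_iff]
  filter_upwards [h0] with x hx hmem
  rw [Set.uIoc_of_le (by gcongr; simp)] at hmem
  rw [floor_div_eq hlam ⟨hmem.1.le, lt_of_le_of_ne hmem.2 hx⟩]

/-- The integral of a function that is constant on the cells of a lattice. -/
lemma integral_step {E : Type*} [NormedAddCommGroup E] [NormedSpace ℝ E] [CompleteSpace E]
    {lam : ℝ} (hlam : 0 < lam) (g : ℕ → E) (s : ℕ) :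
    IntervalIntegrable (fun x => g ⌊x / lam⌋₊) volume 0 (lam * s) ∧
      ∫ x in 0..lam * s, g ⌊x / lam⌋₊ = lam • ∑ j ∈ Finset.range s, g j := by
  induction s with
  | zero => simp
  | succ s ih =>
    push_cast
    have hI : IntervalIntegrable (fun x => g ⌊x / lam⌋₊) volume (lam * s) (lam * (s + 1)) := by
      refine (intervalIntegrable_const (c := g s)).congr_ae ?_
      rw [EventuallyEq, ae_restrict_iff' measurableSet_uIoc]
      filter_upwards [step_ae_eq hlam g s] with x hx hm using (hx hm).symm
    refine ⟨ih.1.trans hI, ?_⟩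
    rw [← intervalIntegral.integral_add_adjacent_intervals ih.1 hI, ih.2,
      intervalIntegral.integral_congr_ae (step_ae_eq hlam g s), Finset.sum_range_succ, smul_add,
      intervalIntegral.integral_const]
    congr 2
    ring

lemma measurable_interp (lam : ℝ) (v : Spins) : Measurable (interp lam v) := by
  have h : Measurable fun n : ℕ => (v n : Plane) := measurable_from_nat
  exact h.comp (Nat.measurable_floor.comp (measurable_id.div_const lam))

lemma norm_interp (lam : ℝ) (v : Spins) (x : ℝ) : ‖interp lam v x‖ = 1 := norm_spin _

lemma intervalIntegrable_interp (lam : ℝ) (v : Spins) (a b : ℝ) :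
    IntervalIntegrable (interp lam v) volume a b := by
  refine (intervalIntegrable_const (c := (1 : ℝ))).mono_fun
    (measurable_interp lam v).aestronglyMeasurable (ae_of_all _ fun x => ?_)
  simp [norm_interp]

/-- Only the incomplete cell containing x contributes to the difference. -/
lemma norm_integral_interp_sub_le {lam : ℝ} (hlam : 0 < lam) (v : Spins) {x : ℝ} (hx : 0 ≤ x) :
    ‖(∫ y in 0..x, interp lam v y) - lam • spinSum ⌊x / lam⌋₊ v‖ ≤ lam := by
  have h := (integral_step hlam (fun n => (v n : Plane)) ⌊x / lam⌋₊).2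
  change ∫ y in 0..lam * ⌊x / lam⌋₊, interp lam v y = lam • spinSum ⌊x / lam⌋₊ v at h
  rw [← h, intervalIntegral.integral_interval_sub_left (intervalIntegrable_interp _ _ _ _)
    (intervalIntegrable_interp _ _ _ _)]
  refine (intervalIntegral.norm_integral_le_of_norm_le_const
    (fun y _ => (norm_interp lam v y).le)).trans ?_
  have h1 := Nat.floor_le (div_nonneg hx hlam.le)
  have h2 := Nat.lt_floor_add_one (x / lam)
  rw [le_div_iff₀ hlam] at h1
  rw [div_lt_iff₀ hlam] at h2
  rw [one_mul, abs_of_nonneg (by linarith)]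
  linarith

lemma volI_eq : volI = volume.restrict (Set.Ioc (0 : ℝ) 1) :=
  Measure.restrict_congr_set Ioo_ae_eq_Ioc

lemma integral_volI {E : Type*} [NormedAddCommGroup E] [NormedSpace ℝ E] (f : ℝ → E) :
    ∫ x, f x ∂volI = ∫ x in 0..1, f x := by
  rw [volI_eq, intervalIntegral.integral_of_le zero_le_one]

lemma integrable_volI_iff {E : Type*} [NormedAddCommGroup E] {f : ℝ → E} :
    Integrable f volI ↔ IntervalIntegrable f volume 0 1 := by
  rw [volI_eq, intervalIntegrable_iff_integrableOn_Ioc_of_le zero_le_one, IntegrableOn]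

lemma integrable_of_LInfI (u : LInfI) : Integrable u volI :=
  (Lp.memLp u).integrable le_top

lemma setIntegral_volI {E : Type*} [NormedAddCommGroup E] [NormedSpace ℝ E] (f : ℝ → E) {x : ℝ}
    (hx : x ∈ Set.Icc (0 : ℝ) 1) : ∫ y in Set.Iic x, f y ∂volI = ∫ y in 0..x, f y := by
  rw [volI_eq, Measure.restrict_restrict measurableSet_Iic, intervalIntegral.integral_of_le hx.1]
  congr 2
  ext y
  simp only [Set.mem_inter_iff, Set.mem_Iic, Set.mem_Ioc]
  exact ⟨fun h => ⟨h.2.1, h.1⟩, fun h => ⟨h.2, h.1, h.2.trans hx.2⟩⟩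

lemma tendsto_of_tendsto_inner {ι : Type*} {l : Filter ι} {u : ι → Plane} {z : Plane}
    (h : ∀ e : Plane, Tendsto (fun i => inner ℝ (u i) e) l (𝓝 (inner ℝ z e))) :
    Tendsto u l (𝓝 z) := by
  have h1 : Tendsto (fun i => WithLp.ofLp (u i)) l (𝓝 (WithLp.ofLp z)) := by
    rw [tendsto_pi_nhds]
    intro j
    have := h (EuclideanSpace.single j 1)
    simpa [EuclideanSpace.inner_single_right] using this
  exact ((PiLp.continuous_toLp 2 _).tendsto _).comp h1

lemma integral_inner_indicator {u : ℝ → Plane} (hu : Integrable u volI) {s : Set ℝ}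
    (hs : MeasurableSet s) (e : Plane) :
    ∫ x, inner ℝ (u x) (s.indicator (fun _ => e) x) ∂volI =
      inner ℝ (∫ x in s, u x ∂volI) e := by
  have : (fun x => inner ℝ (u x) (s.indicator (fun _ => e) x)) =
      s.indicator fun x => inner ℝ e (u x) := by
    funext x
    by_cases hx : x ∈ s <;> simp [hx, real_inner_comm]
  rw [this, integral_indicator hs, integral_inner hu.integrableOn, real_inner_comm]

/-- Weak-* convergence gives the convergence of the primitives. -/
lemma WeakStarTendsto.tendsto_integral {u : ℕ → LInfI} {w : LInfI} (h : WeakStarTendsto u w)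
    {x : ℝ} (hx : x ∈ Set.Icc (0 : ℝ) 1) :
    Tendsto (fun n => ∫ y in 0..x, u n y) atTop (𝓝 (∫ y in 0..x, w y)) := by
  refine tendsto_of_tendsto_inner fun e => ?_
  have := h ((Set.Iic x).indicator fun _ => e)
    ((integrable_const e).indicator measurableSet_Iic)
  simpa only [integral_inner_indicator (integrable_of_LInfI _) measurableSet_Iic,
    setIntegral_volI _ hx] using this

/-- A π-λ argument: half-lines generate the Borel sets, and the uniform bound supplies domination
for countable disjoint unions. -/
lemma tendsto_setIntegral_of_tendsto_integral {u : ℕ → LInfI} {w : LInfI}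
    (hu : ∀ n, ∀ᵐ x ∂volI, ‖u n x‖ ≤ 1)
    (h : ∀ x ∈ Set.Icc (0 : ℝ) 1,
      Tendsto (fun n => ∫ y in 0..x, u n y) atTop (𝓝 (∫ y in 0..x, w y)))
    {s : Set ℝ} (hs : MeasurableSet s) :
    Tendsto (fun n => ∫ y in s, u n y ∂volI) atTop (𝓝 (∫ y in s, w y ∂volI)) := by
  have huniv : Tendsto (fun n => ∫ y, u n y ∂volI) atTop (𝓝 (∫ y, w y ∂volI)) := by
    simpa only [integral_volI] using h 1 (by simp)
  induction s, hs using MeasurableSpace.induction_on_inter (borel_eq_generateFrom_Iic ℝ)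
    isPiSystem_Iic with
  | empty => simp
  | basic t ht =>
    obtain ⟨x, rfl⟩ := ht
    rcases le_total x 0 with hx | hx
    · have : ∀ f : ℝ → Plane, ∫ y in Set.Iic x, f y ∂volI = 0 := fun f => by
        rw [volI_eq, Measure.restrict_restrict measurableSet_Iic]
        have : Set.Iic x ∩ Set.Ioc 0 1 = ∅ := by
          ext y
          simp only [Set.mem_inter_iff, Set.mem_Iic, Set.mem_Ioc, Set.mem_empty_iff_false,
            iff_false]
          rintro ⟨h1, h2, -⟩
          linarith
        simp [this]
      simp only [this, tendsto_const_nhds]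
    rcases le_total x 1 with hx1 | hx1
    · simpa only [setIntegral_volI _ ⟨hx, hx1⟩] using h x ⟨hx, hx1⟩
    · have : ∀ f : ℝ → Plane, ∫ y in Set.Iic x, f y ∂volI = ∫ y, f y ∂volI := fun f => by
        rw [volI_eq, Measure.restrict_restrict measurableSet_Iic]
        congr 2
        exact Set.inter_eq_right.2 fun y hy => hy.2.trans hx1
      simpa only [this] using huniv
  | compl t ht ih =>
    have : ∀ f : LInfI, ∫ y in tᶜ, f y ∂volI = ∫ y, f y ∂volI - ∫ y in t, f y ∂volI := fun f =>
      eq_sub_of_add_eq' (integral_add_compl ht (integrable_of_LInfI f))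
    simpa only [this] using huniv.sub ih
  | iUnion t hd ht ih =>
    have e : ∀ f : LInfI, ∫ y in ⋃ i, t i, f y ∂volI = ∑' i, ∫ y in t i, f y ∂volI := fun f =>
      integral_iUnion ht hd (integrable_of_LInfI f).integrableOn
    simp only [e]
    refine tendsto_tsum_of_dominated_convergence (bound := fun i => volI.real (t i)) ?_ ih ?_
    · refine ENNReal.summable_toReal ?_
      rw [← measure_iUnion hd ht]
      exact measure_ne_top _ _
    · refine Eventually.of_forall fun n i => ?_
      have := norm_setIntegral_le_of_norm_le_const_ae (μ := volI) (s := t i) (f := u n) (C := 1)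
        (measure_lt_top _ _) (ae_restrict_of_ae (hu n) |>.mono fun x hx => hx)
      simpa using this

/-- A converse to `WeakStarTendsto.tendsto_integral` for bounded sequences: simple functions are
dense in L¹, and the pairings are 1-Lipschitz in the L¹ norm of the test function. -/
lemma weakStarTendsto_of_tendsto_integral {u : ℕ → LInfI} {w : LInfI}
    (hu : ∀ n, ∀ᵐ x ∂volI, ‖u n x‖ ≤ 1) (hw : ∀ᵐ x ∂volI, ‖w x‖ ≤ 1)
    (h : ∀ x ∈ Set.Icc (0 : ℝ) 1,
      Tendsto (fun n => ∫ y in 0..x, u n y) atTop (𝓝 (∫ y in 0..x, w y))) :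
    WeakStarTendsto u w := by
  have hint : ∀ (f : LInfI) (g : ℝ → Plane), Integrable g volI → (∀ᵐ x ∂volI, ‖f x‖ ≤ 1) →
      Integrable (fun x => inner ℝ (f x) (g x)) volI := by
    intro f g hg hf
    refine hg.norm.mono' ((Lp.aestronglyMeasurable f).inner hg.1) ?_
    filter_upwards [hf] with x hx
    refine (norm_inner_le_norm _ _).trans ?_
    exact mul_le_of_le_one_left (norm_nonneg _) hx
  have hdiff : ∀ (f : LInfI) (g g' : ℝ → Plane), Integrable g volI → Integrable g' volI →
      (∀ᵐ x ∂volI, ‖f x‖ ≤ 1) →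
      ‖(∫ x, inner ℝ (f x) (g x) ∂volI) - ∫ x, inner ℝ (f x) (g' x) ∂volI‖ ≤
        ∫ x, ‖g x - g' x‖ ∂volI := by
    intro f g g' hg hg' hf
    rw [← integral_sub (hint f g hg hf) (hint f g' hg' hf)]
    refine norm_integral_le_of_norm_le (hg.sub hg').norm ?_
    filter_upwards [hf] with x hx
    rw [← inner_sub_right]
    exact (norm_inner_le_norm _ _).trans (mul_le_of_le_one_left (norm_nonneg _) hx)
  intro g hg
  refine Integrable.induction (μ := volI) (fun g => Tendsto (fun n => ∫ x, inner ℝ (u n x) (g x)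
    ∂volI) atTop (𝓝 (∫ x, inner ℝ (w x) (g x) ∂volI))) ?_ ?_ ?_ ?_ hg
  · intro c s hs _
    simp only [integral_inner_indicator (integrable_of_LInfI _) hs]
    exact (tendsto_setIntegral_of_tendsto_integral hu h hs).inner tendsto_const_nhds
  · intro f g _ hf hg hPf hPg
    have e : ∀ v : LInfI, (∀ᵐ x ∂volI, ‖v x‖ ≤ 1) → ∫ x, inner ℝ (v x) ((f + g) x) ∂volI =
        ∫ x, inner ℝ (v x) (f x) ∂volI + ∫ x, inner ℝ (v x) (g x) ∂volI := by
      intro v hv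
      simp only [Pi.add_apply, inner_add_right]
      exact integral_add (hint v f hf hv) (hint v g hg hv)
    rw [e w hw]
    exact (hPf.add hPg).congr fun n => (e (u n) (hu n)).symm
  · refine isClosed_of_closure_subset fun f hf => ?_
    rw [Set.mem_ofPred_eq, Metric.tendsto_atTop]
    intro ε hε
    obtain ⟨g, hg, hfg⟩ := Metric.mem_closure_iff.1 hf (ε / 3) (by positivity)
    obtain ⟨n₀, hn₀⟩ := Metric.tendsto_atTop.1 hg (ε / 3) (by positivity)
    rw [dist_eq_norm, L1.norm_eq_integral_norm] at hfg
    have e : ∫ x, ‖(f - g) x‖ ∂volI = ∫ x, ‖f x - g x‖ ∂volI := by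
      refine integral_congr_ae ?_
      filter_upwards [Lp.coeFn_sub f g] with x hx
      rw [hx, Pi.sub_apply]
    rw [e] at hfg
    refine ⟨n₀, fun n hn => ?_⟩
    have h1 := hn₀ n hn
    have h2 := hdiff (u n) f g (L1.integrable_coeFn f) (L1.integrable_coeFn g) (hu n)
    have h3 := hdiff w f g (L1.integrable_coeFn f) (L1.integrable_coeFn g) hw
    rw [← dist_eq_norm] at h2 h3
    rw [dist_comm] at h3
    have h4 := dist_triangle4 (∫ x, inner ℝ (u n x) (f x) ∂volI) (∫ x, inner ℝ (u n x) (g x) ∂volI)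
      (∫ x, inner ℝ (w x) (g x) ∂volI) (∫ x, inner ℝ (w x) (f x) ∂volI)
    linarith
  · intro f g hfg _ hP
    have e : ∀ v : LInfI, ∫ x, inner ℝ (v x) (f x) ∂volI = ∫ x, inner ℝ (v x) (g x) ∂volI := by
      intro v
      refine integral_congr_ae ?_
      filter_upwards [hfg] with x hx
      rw [hx]
    simpa only [e] using hP

/-! ### Measurability, cell means and passage to fine partitions -/

lemma epi_subset_norm_le_one {J : ℝ} {p : Plane × ℝ} (h : p ∈ epi J) : ‖p.1‖ ≤ 1 := by
  have hK : IsClosed {p : Plane × ℝ | ‖p.1‖ ≤ 1} := isClosed_le (by fun_prop) (by fun_prop)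
  exact epi_induction hK (fun n _ v t _ => norm_mean_le n v) h

lemma measurable_homDensity {J : ℝ} (hJ : 0 ≤ J) : Measurable (homDensity J) := by
  refine measurable_of_Iic fun t => ?_
  have h1 : IsClosed {z : Plane | (z, t) ∈ epi J} :=
    (isClosed_epi J).preimage (f := fun z : Plane => (z, t)) (by fun_prop)
  -- Outside the unit ball the slice is empty and `sInf ∅ = 0`, so the sublevel sets contain the
  -- exterior exactly when 0 ≤ t.
  have h2 : ∀ z : Plane, ¬ ‖z‖ ≤ 1 → homDensity J z = 0 := fun z hz => by
    have : {s | (z, s) ∈ epi J} = ∅ :=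
      Set.eq_empty_of_forall_notMem fun s hs =>
        hz (epi_subset_norm_le_one (J := J) (p := (z, s)) hs)
    rw [homDensity, this, Real.sInf_empty]
  have e : homDensity J ⁻¹' Set.Iic t =
      {z : Plane | (z, t) ∈ epi J} ∪ ({z : Plane | ‖z‖ ≤ 1}ᶜ ∩ {_z : Plane | 0 ≤ t}) := by
    ext z
    by_cases hz : ‖z‖ ≤ 1
    · simp [hz, homDensity_le_iff hJ hz]
    · have : (z, t) ∉ epi J := fun h =>
        hz (epi_subset_norm_le_one (J := J) (p := (z, t)) h)
      simp [h2 z hz, this, not_le.1 hz]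
  rw [e]
  exact h1.measurableSet.union
    ((measurableSet_le measurable_norm measurable_const).compl.inter (MeasurableSet.const _))

lemma integrable_homDensity {J : ℝ} (hJ : 0 ≤ J) {w : ℝ → Plane} (hw : AEStronglyMeasurable w volI)
    (hw1 : ∀ᵐ x ∂volI, ‖w x‖ ≤ 1) : Integrable (fun x => homDensity J (w x)) volI := by
  refine (integrable_const (J + 1)).mono'
    ((measurable_homDensity hJ).comp_aemeasurable hw.aemeasurable).aestronglyMeasurable ?_
  filter_upwards [hw1] with x hx
  exact abs_homDensity_le hJ hx

/-- The mean of `w` over the interval `[j/M, (j+1)/M]`. -/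
def cellMean {E : Type*} [NormedAddCommGroup E] [NormedSpace ℝ E] (w : ℝ → E) (M j : ℕ) : E :=
  (M : ℝ) • ∫ x in (j / M : ℝ)..((j + 1 : ℕ) / M : ℝ), w x

lemma intervalIntegrable_cell {E : Type*} [NormedAddCommGroup E] {w : ℝ → E} (hw : IntervalIntegrable w volume 0 1) {M j k : ℕ}
    (hj : j ≤ M) (hk : k ≤ M) :
    IntervalIntegrable w volume (j / M : ℝ) (k / M : ℝ) := by
  have h : ∀ i : ℕ, i ≤ M → (i / M : ℝ) ∈ Set.uIcc (0 : ℝ) 1 := fun i hi => by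
    rw [Set.uIcc_of_le zero_le_one]
    exact ⟨by positivity, div_le_one_of_le₀ (by exact_mod_cast hi) (by positivity)⟩
  exact hw.mono_set (Set.uIcc_subset_uIcc (h j hj) (h k hk))

lemma sum_cellMean {E : Type*} [NormedAddCommGroup E] [NormedSpace ℝ E]
    {w : ℝ → E} (hw : IntervalIntegrable w volume 0 1) {M k : ℕ} (hM : 0 < M)
    (hk : k ≤ M) :
    ∑ j ∈ Finset.range k, (1 / M : ℝ) • cellMean w M j = ∫ x in 0..(k / M : ℝ), w x := by
  have hM' : (M : ℝ) ≠ 0 := by positivity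
  simp only [cellMean, smul_smul, one_div_mul_cancel hM', one_smul]
  have := intervalIntegral.sum_integral_adjacent_intervals (f := w) (μ := volume)
    (a := fun j : ℕ => (j / M : ℝ)) (n := k)
    (fun j hj => intervalIntegrable_cell hw (by omega) (by omega))
  simpa using this

lemma cellMean_eq_average {E : Type*} [NormedAddCommGroup E] [NormedSpace ℝ E]
    {w : ℝ → E} {M : ℕ} (hM : 0 < M) (j : ℕ) :
    cellMean w M j = ⨍ x in Set.Ioc (j / M : ℝ) ((j + 1 : ℕ) / M : ℝ), w x := by
  have hM' : (0 : ℝ) < M := by positivity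
  have hle : (j / M : ℝ) ≤ ((j + 1 : ℕ) / M : ℝ) := by gcongr; simp
  rw [cellMean, intervalIntegral.integral_of_le hle, setAverage_eq, Real.volume_real_Ioc_of_le hle]
  congr 1
  push_cast
  field_simp
  ring

lemma cellMean_mem {E : Type*} [NormedAddCommGroup E] [NormedSpace ℝ E]
    [CompleteSpace E] {w : ℝ → E} (hw : IntervalIntegrable w volume 0 1) {K : Set E}
    (hK : Convex ℝ K) (hKc : IsClosed K) (hwK : ∀ᵐ x ∂volI, w x ∈ K) {M j : ℕ} (hj : j < M) :
    cellMean w M j ∈ K := by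
  have hM : 0 < M := by omega
  have hM' : (0 : ℝ) < M := by positivity
  have hlt : (j / M : ℝ) < ((j + 1 : ℕ) / M : ℝ) := by gcongr; simp
  rw [cellMean_eq_average hM]
  refine hK.set_average_mem hKc ?_ (by simp) ?_ ?_
  · rw [Real.volume_Ioc]
    simpa using hlt
  · rw [volI_eq] at hwK
    refine ae_mono (Measure.restrict_mono (Set.Ioc_subset_Ioc (by positivity) ?_) le_rfl) hwK
    exact div_le_one_of_le₀ (by exact_mod_cast hj) hM'.le
  · rw [← intervalIntegrable_iff_integrableOn_Ioc_of_le hlt.le]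
    exact intervalIntegrable_cell hw hj.le hj

/-- Lebesgue's differentiation theorem along the cells of the lattices `ℤ/M`. -/
lemma ae_tendsto_cellMean {E : Type*} [NormedAddCommGroup E] [NormedSpace ℝ E]
    [CompleteSpace E] {w : ℝ → E} (hw : IntervalIntegrable w volume 0 1) :
    ∀ᵐ x ∂volI, Tendsto (fun M : ℕ => cellMean w (M + 1) ⌊x / (1 / ((M + 1 : ℕ) : ℝ))⌋₊) atTop
      (𝓝 (w x)) := by
  set W := (Set.Ioc (0 : ℝ) 1).indicator w
  have hW : LocallyIntegrable W volume := by
    rw [intervalIntegrable_iff_integrableOn_Ioc_of_le zero_le_one] at hw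
    exact (hw.integrable_indicator measurableSet_Ioc).locallyIntegrable
  have h := IsUnifLocDoublingMeasure.ae_tendsto_average (μ := (volume : Measure ℝ)) hW 1
  rw [ae_restrict_iff' measurableSet_Ioo]
  filter_upwards [h] with x hx hx01
  have hfl : ∀ M : ℕ, ((⌊x / (1 / ((M + 1 : ℕ) : ℝ))⌋₊ : ℝ) ≤ x * (M + 1 : ℕ) ∧
      x * (M + 1 : ℕ) < ⌊x / (1 / ((M + 1 : ℕ) : ℝ))⌋₊ + 1) := fun M => by
    rw [div_div_eq_mul_div, div_one]
    exact ⟨Nat.floor_le (by have := hx01.1; positivity), Nat.lt_floor_add_one _⟩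
  -- The cell containing x is, up to an endpoint, the closed ball around its midpoint with half its
  -- length as radius.
  have := hx (l := atTop)
    (fun M : ℕ => (((⌊x / (1 / ((M + 1 : ℕ) : ℝ))⌋₊ : ℕ) : ℝ) + 1 / 2) / ((M + 1 : ℕ) : ℝ))
    (fun M : ℕ => 1 / 2 / ((M + 1 : ℕ) : ℝ)) ?_ ?_
  · have hWx : W x = w x := Set.indicator_of_mem (show x ∈ Set.Ioc (0 : ℝ) 1 from ⟨hx01.1, hx01.2.le⟩) _
    rw [hWx] at this
    refine this.congr fun M => ?_
    have hM' : (0 : ℝ) < (M + 1 : ℕ) := by positivity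
    obtain ⟨h1, h2⟩ := hfl M
    rw [cellMean_eq_average (Nat.succ_pos M)]
    set j := ⌊x / (1 / ((M + 1 : ℕ) : ℝ))⌋₊
    have hj : j + 1 ≤ M + 1 := by
      have : (j : ℝ) < ((M + 1 : ℕ) : ℝ) := h1.trans_lt (by nlinarith [hx01.2])
      exact_mod_cast this
    have e1 : Metric.closedBall (((j : ℝ) + 1 / 2) / ((M + 1 : ℕ) : ℝ))
        (1 / 2 / ((M + 1 : ℕ) : ℝ)) =
        Set.Icc (j / ((M + 1 : ℕ) : ℝ)) ((j + 1 : ℕ) / ((M + 1 : ℕ) : ℝ)) := by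
      rw [Real.closedBall_eq_Icc, ← sub_div, ← add_div]
      congr 2 <;> · push_cast; ring
    rw [e1, setAverage_congr Ioc_ae_eq_Icc.symm]
    refine setAverage_congr_fun measurableSet_Ioc (ae_of_all _ fun y hy => ?_)
    refine Set.indicator_of_mem (show y ∈ Set.Ioc (0 : ℝ) 1 from
      ⟨lt_of_le_of_lt (by positivity) hy.1, hy.2.trans ?_⟩) _
    exact div_le_one_of_le₀ (by exact_mod_cast hj) hM'.le
  · refine tendsto_nhdsWithin_iff.2 ⟨?_, Eventually.of_forall fun M => ?_⟩
    · exact (tendsto_const_div_atTop_nhds_zero_nat (1 / 2 : ℝ)).comp (tendsto_add_atTop_nat 1)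
    · simp only [Set.mem_Ioi]; positivity
  · refine Eventually.of_forall fun M => ?_
    have hM' : (0 : ℝ) < (M + 1 : ℕ) := by positivity
    obtain ⟨h1, h2⟩ := hfl M
    rw [one_mul, Real.closedBall_eq_Icc, ← sub_div, ← add_div, Set.mem_Icc, div_le_iff₀ hM',
      le_div_iff₀ hM']
    constructor <;> linarith

/-- Lower semicontinuity in the form required by Fatou's lemma; adding J + 1 makes the density
nonnegative on the ball. -/
lemma le_liminf_ofReal {J : ℝ} (hJ : 0 ≤ J) {u : ℕ → Plane} {z : Plane} (hu : ∀ i, ‖u i‖ ≤ 1)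
    (hz : ‖z‖ ≤ 1) (h : Tendsto u atTop (𝓝 z)) :
    ENNReal.ofReal (homDensity J z + (J + 1)) ≤
      liminf (fun n => ENNReal.ofReal (homDensity J (u n) + (J + 1))) atTop := by
  refine le_of_forall_lt fun c hc => ?_
  obtain ⟨d, hcd, hd⟩ := exists_between hc
  refine hcd.trans_le (le_liminf_of_le (by isBoundedDefault) ?_)
  have hd' := ENNReal.toReal_lt_of_lt_ofReal hd
  filter_upwards [eventually_lt_homDensity hJ hu hz h
    (show d.toReal - (J + 1) < homDensity J z by linarith)] with n hn
  rw [← ENNReal.ofReal_toReal hd.ne_top]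
  exact ENNReal.ofReal_le_ofReal (by linarith)

/-- The bound of the energy of the piecewise constant means passes to the limit. -/
lemma integral_homDensity_le {J : ℝ} (hJ : 0 ≤ J) {w : ℝ → Plane} (hw : Integrable w volI) {a : ℝ}
    (hmean : ∀ M : ℕ, 0 < M → ∀ j < M, ‖cellMean w M j‖ ≤ 1)
    (hsum : ∀ M : ℕ, 0 < M →
      ∑ j ∈ Finset.range M, (1 / M : ℝ) * homDensity J (cellMean w M j) ≤ a) :
    (∀ᵐ x ∂volI, ‖w x‖ ≤ 1) ∧ ∫ x, homDensity J (w x) ∂volI ≤ a := by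
  have hwI := integrable_volI_iff.1 hw
  have hlim := ae_tendsto_cellMean hwI
  set c : ℕ → ℝ → Plane := fun M x => cellMean w (M + 1) ⌊x / (1 / ((M + 1 : ℕ) : ℝ))⌋₊ with hc
  have hc1 : ∀ M, ∀ x ∈ Set.Ioo (0 : ℝ) 1, ‖c M x‖ ≤ 1 := fun M x hx => by
    refine hmean _ M.succ_pos _ ?_
    rw [div_div_eq_mul_div, div_one, Nat.floor_lt (by have := hx.1; positivity)]
    have : (0 : ℝ) < (M + 1 : ℕ) := by positivity
    nlinarith [hx.2]
  have hmem : ∀ᵐ x ∂volI, x ∈ Set.Ioo (0 : ℝ) 1 := ae_restrict_mem measurableSet_Ioo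
  have hw1 : ∀ᵐ x ∂volI, ‖w x‖ ≤ 1 := by
    filter_upwards [hlim, hmem] with x hx hx01
    exact le_of_tendsto hx.norm (Eventually.of_forall fun M => hc1 M x hx01)
  refine ⟨hw1, ?_⟩
  have hcm : ∀ M, Measurable (c M) := fun M => by
    have h : Measurable fun n : ℕ => cellMean w (M + 1) n := measurable_from_nat
    exact h.comp (Nat.measurable_floor.comp (measurable_id.div_const _))
  have hci : ∀ M, Integrable (fun x => homDensity J (c M x)) volI := fun M =>
    integrable_homDensity hJ (hcm M).aestronglyMeasurable
      (by filter_upwards [hmem] with x hx using hc1 M x hx)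
  have hwi := integrable_homDensity hJ hw.1 hw1
  have hca : ∀ M, ∫ x, (homDensity J (c M x) + (J + 1)) ∂volI ≤ a + (J + 1) := fun M => by
    rw [integral_add (hci M) (integrable_const _), integral_volI]
    have h := (integral_step (lam := 1 / ((M + 1 : ℕ) : ℝ)) (by positivity)
      (fun j => homDensity J (cellMean w (M + 1) j)) (M + 1)).2
    rw [one_div_mul_cancel (by positivity)] at h
    rw [h, smul_eq_mul, Finset.mul_sum]
    have := hsum (M + 1) M.succ_pos
    simpa using this
  have hnn : ∀ z : Plane, ‖z‖ ≤ 1 → 0 ≤ homDensity J z + (J + 1) := fun z hz => by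
    linarith [neg_le_homDensity hJ hz]
  have hfatou : ∫⁻ x, ENNReal.ofReal (homDensity J (w x) + (J + 1)) ∂volI ≤
      ENNReal.ofReal (a + (J + 1)) := by
    calc _ ≤ ∫⁻ x, liminf (fun M => ENNReal.ofReal (homDensity J (c M x) + (J + 1))) atTop
          ∂volI := by
          refine lintegral_mono_ae ?_
          filter_upwards [hlim, hmem, hw1] with x hx hx01 hx1
          exact le_liminf_ofReal hJ (fun M => hc1 M x hx01) hx1 hx
      _ ≤ liminf (fun M => ∫⁻ x, ENNReal.ofReal (homDensity J (c M x) + (J + 1)) ∂volI) atTop :=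
          lintegral_liminf_le fun M =>
            (((measurable_homDensity hJ).comp (hcm M)).add_const _).ennreal_ofReal
      _ ≤ _ := by
          refine liminf_le_of_frequently_le' (Frequently.of_forall fun M => ?_)
          rw [← ofReal_integral_eq_lintegral_ofReal
            (f := fun x => homDensity J (c M x) + (J + 1)) ((hci M).add (integrable_const _))]
          · exact ENNReal.ofReal_le_ofReal (hca M)
          · filter_upwards [hmem] with x hx using hnn _ (hc1 M x hx)
  rw [← ofReal_integral_eq_lintegral_ofReal (f := fun x => homDensity J (w x) + (J + 1))
    (hwi.add (integrable_const _)) (by filter_upwards [hw1] with x hx using hnn _ hx)] at hfatou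
  -- Nonnegativity is needed to leave `ENNReal`, because `ofReal` truncates at 0.
  have h0 : 0 ≤ a + (J + 1) :=
    (integral_nonneg_of_ae (by filter_upwards [hmem] with x hx using hnn _ (hc1 0 x hx))).trans
      (hca 0)
  rw [ENNReal.ofReal_le_ofReal_iff h0, integral_add hwi (integrable_const _)] at hfatou
  simpa using hfatou

/-! ### The liminf inequality on a fixed partition -/

/-- The first lattice index of the `j`-th of `M` equal parts of the interval. -/
def node (M : ℕ) (lam : ℝ) (j : ℕ) : ℕ := ⌊(j / M : ℝ) / lam⌋₊

lemma node_zero (M : ℕ) (lam : ℝ) : node M lam 0 = 0 := by simp [node]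

lemma node_self {M : ℕ} (hM : 0 < M) (lam : ℝ) : node M lam M = ⌊1 / lam⌋₊ := by
  have : (M : ℝ) ≠ 0 := by positivity
  simp [node, this]

lemma node_mono (M : ℕ) {lam : ℝ} (hlam : 0 < lam) : Monotone (node M lam) := by
  intro i j hij
  unfold node
  gcongr

lemma tendsto_mul_node (M j : ℕ) {ι : Type*} {l : Filter ι} {lam : ι → ℝ} (hpos : ∀ i, 0 < lam i)
    (hlam : Tendsto lam l (𝓝 0)) :
    Tendsto (fun i => lam i * node M (lam i) j) l (𝓝 (j / M)) := by
  have h1 : Tendsto (fun i => (j / M : ℝ) - lam i) l (𝓝 (j / M)) := by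
    simpa using (tendsto_const_nhds (x := (j / M : ℝ))).sub hlam
  refine tendsto_of_tendsto_of_tendsto_of_le_of_le h1 tendsto_const_nhds (fun i => ?_) fun i => ?_
  · have := Nat.lt_floor_add_one ((j / M : ℝ) / lam i)
    rw [div_lt_iff₀ (hpos i)] at this
    change _ ≤ lam i * (⌊(j / M : ℝ) / lam i⌋₊ : ℝ)
    linarith
  · have := Nat.floor_le (div_nonneg (by positivity : (0 : ℝ) ≤ j / M) (hpos i).le)
    rw [le_div_iff₀ (hpos i)] at this
    change lam i * (⌊(j / M : ℝ) / lam i⌋₊ : ℝ) ≤ j / M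
    linarith

/-- The number of lattice indices in the `j`-th of `M` equal parts of the interval. -/
def nodeLen (M : ℕ) (lam : ℝ) (j : ℕ) : ℕ := node M lam (j + 1) - node M lam j

lemma node_add_nodeLen (M : ℕ) {lam : ℝ} (hlam : 0 < lam) (j : ℕ) :
    node M lam j + nodeLen M lam j = node M lam (j + 1) :=
  Nat.add_sub_of_le (node_mono M hlam j.le_succ)

lemma tendsto_mul_nodeLen (M j : ℕ) {ι : Type*} {l : Filter ι} {lam : ι → ℝ}
    (hpos : ∀ i, 0 < lam i) (hlam : Tendsto lam l (𝓝 0)) :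
    Tendsto (fun i => lam i * nodeLen M (lam i) j) l (𝓝 (1 / M)) := by
  have h := (tendsto_mul_node M (j + 1) hpos hlam).sub (tendsto_mul_node M j hpos hlam)
  have e : ((j + 1 : ℕ) / M : ℝ) - j / M = 1 / M := by push_cast; ring
  rw [e] at h
  refine h.congr fun i => ?_
  rw [← node_add_nodeLen M (hpos i) j]
  push_cast
  ring

lemma chainEnergy_ge {J : ℝ} (hJ : 0 ≤ J) (N : ℕ) (v : Spins) :
    partialEnergy J N v - (J + 1) ≤ chainEnergy J N v := by
  rw [chainEnergy_eq]
  rcases N with _ | N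
  · simp; linarith
  · rw [partialEnergy_succ]
    have := abs_le.1 (abs_bondEnergy_le hJ v N)
    simp only [add_tsub_cancel_right]
    linarith

lemma sum_homDensity_le_partialEnergy {J : ℝ} (hJ : 0 ≤ J) (M : ℕ) {lam : ℝ} (hlam : 0 < lam)
    (v : Spins) (k : ℕ) :
    ∑ j ∈ Finset.range k, ((nodeLen M lam j : ℝ) * homDensity J ((nodeLen M lam j : ℝ)⁻¹ •
      spinSum (nodeLen M lam j) (shift (node M lam j) v)) - interfaceCost J) ≤
      partialEnergy J (node M lam k) v := by
  induction k with
  | zero => simp [node_zero, partialEnergy]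
  | succ k ih =>
    rw [Finset.sum_range_succ, ← node_add_nodeLen M hlam k, partialEnergy_add]
    have := homDensity_mean_le hJ (nodeLen M lam k) (shift (node M lam k) v)
    linarith

/-- A scaled block sum is the increment of a primitive between two nodes up to O(lam), and the
scaled block length tends to 1/M. -/
lemma tendsto_block_mean {M : ℕ} (hM : 0 < M) {lam : ℕ → ℝ} (hpos : ∀ n, 0 < lam n)
    (hlam : Tendsto lam atTop (𝓝 0)) {v : ℕ → Spins} {w : ℝ → Plane}
    (hw : IntervalIntegrable w volume 0 1)
    (hconv : ∀ x ∈ Set.Icc (0 : ℝ) 1,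
      Tendsto (fun n => ∫ y in 0..x, interp (lam n) (v n) y) atTop (𝓝 (∫ y in 0..x, w y)))
    {j : ℕ} (hj : j < M) :
    Tendsto (fun n => (nodeLen M (lam n) j : ℝ)⁻¹ •
      spinSum (nodeLen M (lam n) j) (shift (node M (lam n) j) (v n))) atTop
      (𝓝 (cellMean w M j)) := by
  have hM' : (M : ℝ) ≠ 0 := by positivity
  have hmem : ∀ k : ℕ, k ≤ M → (k / M : ℝ) ∈ Set.Icc (0 : ℝ) 1 := fun k hk =>
    ⟨by positivity, div_le_one_of_le₀ (by exact_mod_cast hk) (by positivity)⟩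
  have hsum : ∀ k : ℕ, k ≤ M → Tendsto (fun n => lam n • spinSum (node M (lam n) k) (v n)) atTop
      (𝓝 (∫ y in 0..(k / M : ℝ), w y)) := by
    intro k hk
    have h0 : Tendsto (fun n => (∫ y in 0..(k / M : ℝ), interp (lam n) (v n) y) -
        lam n • spinSum (node M (lam n) k) (v n)) atTop (𝓝 0) :=
      squeeze_zero_norm (fun n => norm_integral_interp_sub_le (hpos n) (v n) (hmem k hk).1) hlam
    have := (hconv _ (hmem k hk)).sub h0
    simpa using this
  have h1 := (hsum (j + 1) hj).sub (hsum j hj.le)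
  have hzero : IntervalIntegrable w volume 0 (j / M : ℝ) := by
    simpa using intervalIntegrable_cell hw (M := M) (j := 0) (k := j) (by omega) hj.le
  have hzero' : IntervalIntegrable w volume 0 ((j + 1 : ℕ) / M : ℝ) := by
    simpa using intervalIntegrable_cell hw (M := M) (j := 0) (k := j + 1) (by omega) hj
  rw [intervalIntegral.integral_interval_sub_left hzero' hzero] at h1
  have h2 := ((tendsto_mul_nodeLen M j hpos hlam).inv₀ (by positivity)).smul h1
  rw [one_div, inv_inv] at h2
  refine h2.congr fun n => ?_
  rw [← node_add_nodeLen M (hpos n) j, spinSum_add, smul_add, add_sub_cancel_left, smul_smul]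
  congr 1
  have := (hpos n).ne'
  rw [mul_inv, mul_comm, ← mul_assoc, mul_inv_cancel₀ this, one_mul]

/-- The lower bound for sequences of configurations of bounded energy. -/
lemma integral_homDensity_le_of_energy_le {J : ℝ} (hJ : 0 ≤ J) {lam : ℕ → ℝ}
    (hpos : ∀ n, 0 < lam n) (hlam : Tendsto lam atTop (𝓝 0)) {v : ℕ → Spins} {w : ℝ → Plane}
    (hw : Integrable w volI)
    (hconv : ∀ x ∈ Set.Icc (0 : ℝ) 1,
      Tendsto (fun n => ∫ y in 0..x, interp (lam n) (v n) y) atTop (𝓝 (∫ y in 0..x, w y)))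
    {a : ℝ} (ha : ∀ n, lam n * chainEnergy J ⌊1 / lam n⌋₊ (v n) ≤ a) :
    (∀ᵐ x ∂volI, ‖w x‖ ≤ 1) ∧ ∫ x, homDensity J (w x) ∂volI ≤ a := by
  have hlimB := fun (M : ℕ) (hM : 0 < M) (j : ℕ) (hj : j < M) =>
    tendsto_block_mean hM hpos hlam (integrable_volI_iff.1 hw) hconv hj
  have hmean : ∀ M : ℕ, 0 < M → ∀ j < M, ‖cellMean w M j‖ ≤ 1 := fun M hM j hj =>
    le_of_tendsto (hlimB M hM j hj).norm (Eventually.of_forall fun n => norm_mean_le _ _)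
  refine integral_homDensity_le hJ hw hmean fun M hM => ?_
  -- The density is only known to be lower semicontinuous, so its values at the block means are
  -- bounded below by the limit value minus δ.
  refine le_of_forall_pos_le_add fun δ hδ => ?_
  have hM' : (M : ℝ) ≠ 0 := by positivity
  have hlow : Tendsto (fun n => ∑ j ∈ Finset.range M,
      (lam n * nodeLen M (lam n) j) * (homDensity J (cellMean w M j) - δ) -
        lam n * (M * interfaceCost J + (J + 1))) atTop
      (𝓝 (∑ j ∈ Finset.range M, (1 / M : ℝ) * (homDensity J (cellMean w M j) - δ) -
        0 * (M * interfaceCost J + (J + 1)))) :=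
    (tendsto_finsetSum _ fun j _ => (tendsto_mul_nodeLen M j hpos hlam).mul_const _).sub
      (hlam.mul_const _)
  have hev : ∀ᶠ n in atTop, ∀ j ∈ Finset.range M, homDensity J (cellMean w M j) - δ <
      homDensity J ((nodeLen M (lam n) j : ℝ)⁻¹ •
        spinSum (nodeLen M (lam n) j) (shift (node M (lam n) j) (v n))) := by
    rw [Filter.eventually_all_finset]
    intro j hj
    have hj := Finset.mem_range.1 hj
    exact eventually_lt_homDensity hJ (fun n => norm_mean_le _ _) (hmean M hM j hj)
      (hlimB M hM j hj) (by linarith)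
  have hle := le_of_tendsto hlow (b := a) (by
    filter_upwards [hev] with n hn
    refine le_trans ?_ (ha n)
    have h1 := chainEnergy_ge hJ ⌊1 / lam n⌋₊ (v n)
    have h2 := sum_homDensity_le_partialEnergy hJ M (hpos n) (v n) M
    rw [node_self hM, Finset.sum_sub_distrib, Finset.sum_const, Finset.card_range,
      nsmul_eq_mul] at h2
    have h3 : ∑ j ∈ Finset.range M,
        (nodeLen M (lam n) j : ℝ) * (homDensity J (cellMean w M j) - δ) ≤
        ∑ j ∈ Finset.range M, (nodeLen M (lam n) j : ℝ) *
          homDensity J ((nodeLen M (lam n) j : ℝ)⁻¹ •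
            spinSum (nodeLen M (lam n) j) (shift (node M (lam n) j) (v n))) :=
      Finset.sum_le_sum fun j hj => by
        have := hn j hj
        gcongr
    simp only [mul_assoc]
    rw [← Finset.mul_sum, ← mul_sub]
    have := (hpos n).le
    gcongr
    linarith)
  simp only [mul_sub, Finset.sum_sub_distrib, Finset.sum_const, Finset.card_range,
    nsmul_eq_mul] at hle
  rw [← mul_assoc, mul_one_div_cancel hM'] at hle
  linarith

/-! ### Construction of recovery sequences -/

/-- Blocks of given lengths can be put in a row. -/
lemma exists_concat {J : ℝ} (hJ : 0 ≤ J) (s m : ℕ → ℕ) (hs0 : s 0 = 0)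
    (hs : ∀ j, s j + m j = s (j + 1)) (b : ℕ → Spins) (M : ℕ) :
    ∃ v : Spins, (∀ k ≤ M, spinSum (s k) v = ∑ j ∈ Finset.range k, spinSum (m j) (b j)) ∧
      partialEnergy J (s M) v ≤
        ∑ j ∈ Finset.range M, (partialEnergy J (m j) (b j) + interfaceCost J) := by
  have hmono : Monotone s := monotone_nat_of_le_succ fun j => by rw [← hs]; omega
  induction M with
  | zero =>
    refine ⟨b 0, fun k hk => ?_, ?_⟩
    · obtain rfl : k = 0 := by omega
      simp [hs0, spinSum]
    · simp [hs0, partialEnergy]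
  | succ M ih =>
    obtain ⟨v, hv, hv'⟩ := ih
    refine ⟨concat (s M) v (b M), fun k hk => ?_, ?_⟩
    · rcases Nat.of_le_succ hk with hk | rfl
      · rw [← hv k hk]
        exact spinSum_congr fun i hi => concat_of_lt _ _ (hi.trans_le (hmono hk))
      · rw [← hs, spinSum_concat, hv M le_rfl, Finset.sum_range_succ]
    · rw [← hs, Finset.sum_range_succ]
      have := partialEnergy_concat_le hJ (s M) (m M) v (b M)
      linarith

lemma chainEnergy_le_partialEnergy {J : ℝ} (hJ : 0 ≤ J) {N : ℕ} {v w : Spins}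
    (h : ∀ i, i ≠ N → w i = v i) :
    chainEnergy J N w ≤ partialEnergy J N v + 5 * (J + 1) := by
  have h1 := chainEnergy_le_of_eq hJ h
  rcases N with _ | N
  · simp at h1 ⊢; linarith
  · rw [partialEnergy_succ]
    have := abs_le.1 (abs_bondEnergy_le hJ v N)
    simp only [add_tsub_cancel_right] at h1
    linarith

lemma intervalIntegral_congr_volI {E : Type*} [NormedAddCommGroup E] [NormedSpace ℝ E]
    {f g : ℝ → E} (h : f =ᵐ[volI] g) {x : ℝ} (hx : x ∈ Set.Icc (0 : ℝ) 1) :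
    ∫ y in 0..x, f y = ∫ y in 0..x, g y := by
  rw [← setIntegral_volI f hx, ← setIntegral_volI g hx]
  exact integral_congr_ae (ae_restrict_of_ae h)

lemma norm_integral_sub_integral_le {w : ℝ → Plane} (hw : IntervalIntegrable w volume 0 1)
    (hw1 : ∀ᵐ x ∂volI, ‖w x‖ ≤ 1) {a b : ℝ} (ha : 0 ≤ a) (hab : a ≤ b) (hb : b ≤ 1) :
    ‖(∫ y in 0..b, w y) - ∫ y in 0..a, w y‖ ≤ b - a := by
  have hI : ∀ c : ℝ, 0 ≤ c → c ≤ 1 → IntervalIntegrable w volume 0 c := fun c h0 h1 =>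
    hw.mono_set (Set.uIcc_subset_uIcc Set.left_mem_uIcc
      (by rw [Set.uIcc_of_le zero_le_one]; exact ⟨h0, h1⟩))
  rw [intervalIntegral.integral_interval_sub_left (hI b (ha.trans hab) hb)
    (hI a ha (hab.trans hb))]
  rw [volI_eq, ae_restrict_iff' measurableSet_Ioc] at hw1
  refine (intervalIntegral.norm_integral_le_of_norm_le_const_ae (C := 1) ?_).trans ?_
  · filter_upwards [hw1] with y hy hy'
    rw [Set.uIoc_of_le hab] at hy'
    exact hy ⟨ha.trans_lt hy'.1, hy'.2.trans hb⟩
  · rw [one_mul, abs_of_nonneg (sub_nonneg.2 hab)]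

lemma cellMean_clm {E F : Type*} [NormedAddCommGroup E] [NormedSpace ℝ E] [CompleteSpace E]
    [NormedAddCommGroup F] [NormedSpace ℝ F] [CompleteSpace F] (L : E →L[ℝ] F) {w : ℝ → E}
    (hw : IntervalIntegrable w volume 0 1) {M j : ℕ} (hj : j < M) :
    cellMean (fun x => L (w x)) M j = L (cellMean w M j) := by
  rw [cellMean, cellMean, map_smul,
    L.intervalIntegral_comp_comm (intervalIntegrable_cell hw hj.le hj)]

/-- Jensen's inequality on the cells. -/
lemma cellMean_mem_epi {J : ℝ} (hJ : 0 ≤ J) {w : ℝ → Plane} (hw : Integrable w volI)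
    (hw1 : ∀ᵐ x ∂volI, ‖w x‖ ≤ 1) {M j : ℕ} (hj : j < M) :
    (cellMean w M j, cellMean (fun x => homDensity J (w x)) M j) ∈ epi J := by
  have hp : IntervalIntegrable (fun x => (w x, homDensity J (w x))) volume 0 1 :=
    integrable_volI_iff.1 (hw.prodMk (integrable_homDensity hJ hw.1 hw1))
  have h := cellMean_mem hp (convex_epi hJ) (isClosed_epi J)
    (by filter_upwards [hw1] with x hx using homDensity_mem_epi hJ hx) hj
  have h1 := cellMean_clm (ContinuousLinearMap.fst ℝ Plane ℝ) hp hj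
  have h2 := cellMean_clm (ContinuousLinearMap.snd ℝ Plane ℝ) hp hj
  simp only [ContinuousLinearMap.coe_fst', ContinuousLinearMap.coe_snd'] at h1 h2
  rw [h1, h2]
  exact h

lemma sum_nodeLen (M : ℕ) {lam : ℝ} (hlam : 0 < lam) (k : ℕ) :
    ∑ j ∈ Finset.range k, nodeLen M lam j = node M lam k := by
  induction k with
  | zero => simp [node_zero]
  | succ k ih => rw [Finset.sum_range_succ, ih, node_add_nodeLen M hlam]

/-- Configurations that are close to `w` and have almost the energy of the homogenized
functional. -/
lemma eventually_exists_recovery {J : ℝ} (hJ : 0 ≤ J) {lam : ℕ → ℝ} (hpos : ∀ n, 0 < lam n)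
    (hlam : Tendsto lam atTop (𝓝 0)) {w : ℝ → Plane} (hw : Integrable w volI)
    (hw1 : ∀ᵐ x ∂volI, ‖w x‖ ≤ 1) {ε : ℝ} (hε : 0 < ε) :
    ∀ᶠ n in atTop, ∃ v, PeriodicBC ⌊1 / lam n⌋₊ v ∧
      (∀ x ∈ Set.Icc (0 : ℝ) 1,
        ‖(∫ y in 0..x, interp (lam n) v y) - ∫ y in 0..x, w y‖ ≤ ε) ∧
      lam n * chainEnergy J ⌊1 / lam n⌋₊ v ≤ ∫ x, homDensity J (w x) ∂volI + ε := by
  have hwI := integrable_volI_iff.1 hw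
  have hfI := integrable_volI_iff.1 (integrable_homDensity hJ hw.1 hw1)
  -- At the nodes there are three errors of size δ (interpolation, block means, Riemann sums); a
  -- fourth, 2/M ≤ δ, covers the points between nodes.
  set δ := ε / 4 with hδε
  have hδ : 0 < δ := by positivity
  obtain ⟨M, hMδ⟩ := exists_nat_gt (2 / δ)
  have hM' : (0 : ℝ) < M := (by positivity : 0 < 2 / δ).trans hMδ
  have hM : 0 < M := by exact_mod_cast hM'
  have hMδ' : 2 * (1 / M : ℝ) ≤ δ := by
    rw [div_lt_iff₀ hδ] at hMδ
    rw [mul_one_div, div_le_iff₀ hM']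
    linarith
  set A : ℕ → Plane := cellMean w M with hA
  set t : ℕ → ℝ := cellMean (fun x => homDensity J (w x)) M with ht
  have hblock : ∀ j : ℕ, ∃ n₀ : ℕ, j < M → ∀ n ≥ n₀, ∃ v,
      ‖spinSum n v - (n : ℝ) • A j‖ ≤ δ * n ∧
      partialEnergy J n v + interfaceCost J ≤ n * (t j + δ) := fun j => by
    by_cases hj : j < M
    · obtain ⟨n₀, h⟩ := exists_block hJ (cellMean_mem_epi hJ hw hw1 hj) hδ
      exact ⟨n₀, fun _ => h⟩
    · exact ⟨0, fun h => absurd h hj⟩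
  choose n₀ hn₀ using hblock
  have hlen : ∀ᶠ n in atTop, ∀ j ∈ Finset.range M, n₀ j ≤ nodeLen M (lam n) j := by
    rw [Filter.eventually_all_finset]
    intro j _
    have h1 : Tendsto (fun n => lam n * n₀ j) atTop (𝓝 0) := by
      simpa using hlam.mul_const (n₀ j : ℝ)
    filter_upwards [h1.eventually_lt (tendsto_mul_nodeLen M j hpos hlam) (by positivity)] with n hn
    exact_mod_cast (lt_of_mul_lt_mul_left hn (hpos n).le).le
  have hRiem : ∀ᶠ n in atTop, ∀ k ∈ Finset.range (M + 1),
      ‖∑ j ∈ Finset.range k, (lam n * nodeLen M (lam n) j) • A j -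
        ∫ y in 0..(k / M : ℝ), w y‖ ≤ δ := by
    rw [Filter.eventually_all_finset]
    intro k hk
    have hk : k ≤ M := Nat.lt_succ_iff.1 (Finset.mem_range.1 hk)
    have h : Tendsto (fun n => ∑ j ∈ Finset.range k, (lam n * nodeLen M (lam n) j) • A j) atTop
        (𝓝 (∫ y in 0..(k / M : ℝ), w y)) := by
      rw [← sum_cellMean hwI hM hk]
      exact tendsto_finsetSum _ fun j _ => (tendsto_mul_nodeLen M j hpos hlam).smul_const _
    have := (tendsto_iff_norm_sub_tendsto_zero.1 h).eventually_lt_const hδ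
    filter_upwards [this] with n hn using hn.le
  have hEn : ∀ᶠ n in atTop, ∑ j ∈ Finset.range M, (lam n * nodeLen M (lam n) j) * (t j + δ) +
      lam n * (5 * (J + 1)) ≤ ∫ x, homDensity J (w x) ∂volI + ε := by
    have h : Tendsto (fun n => ∑ j ∈ Finset.range M, (lam n * nodeLen M (lam n) j) * (t j + δ) +
        lam n * (5 * (J + 1))) atTop
        (𝓝 (∑ j ∈ Finset.range M, (1 / M : ℝ) * (t j + δ) + 0 * (5 * (J + 1)))) :=
      (tendsto_finsetSum _ fun j _ => (tendsto_mul_nodeLen M j hpos hlam).mul_const _).add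
        (hlam.mul_const _)
    have e : ∑ j ∈ Finset.range M, (1 / M : ℝ) * (t j + δ) + 0 * (5 * (J + 1)) =
        ∫ x, homDensity J (w x) ∂volI + δ := by
      have := sum_cellMean hfI hM le_rfl
      rw [div_self hM'.ne', ← integral_volI] at this
      simp only [smul_eq_mul] at this
      simp only [mul_add, Finset.sum_add_distrib, Finset.sum_const, Finset.card_range,
        nsmul_eq_mul]
      rw [this]
      field_simp
      ring
    rw [e] at h
    filter_upwards [h.eventually_lt_const (show _ < ∫ x, homDensity J (w x) ∂volI + ε by
      linarith)] with n hn using hn.le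
  filter_upwards [hlen, hRiem, hEn, hlam.eventually_lt_const hδ,
    hlam.eventually_lt_const (show (0 : ℝ) < 1 / 2 by norm_num)] with n hlen hRiem hEn hlamδ hlam2
  have hl := hpos n
  set l := lam n
  have hbex : ∀ j : ℕ, ∃ b : Spins, j < M →
      ‖spinSum (nodeLen M l j) b - (nodeLen M l j : ℝ) • A j‖ ≤ δ * nodeLen M l j ∧
      partialEnergy J (nodeLen M l j) b + interfaceCost J ≤ nodeLen M l j * (t j + δ) := fun j => by
    by_cases hj : j < M
    · obtain ⟨b, hb⟩ := hn₀ j hj _ (hlen j (Finset.mem_range.2 hj))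
      exact ⟨b, fun _ => hb⟩
    · exact ⟨helix 0, fun h => absurd h hj⟩
  choose b hb using hbex
  obtain ⟨v, hvS, hvE⟩ := exists_concat hJ (node M l) (nodeLen M l) (node_zero M l)
    (node_add_nodeLen M hl) b M
  have hN : node M l M = ⌊1 / l⌋₊ := node_self hM l
  have hN2 : 2 ≤ ⌊1 / l⌋₊ := by
    rw [Nat.le_floor_iff (by positivity), le_div_iff₀ hl]
    push_cast
    linarith
  obtain ⟨u, hu, huv⟩ := exists_periodicBC hN2 v
  -- The altered spin has index N, while the sums up to the last node involve only indices below N.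
  have huS : ∀ k ≤ M, spinSum (node M l k) u = spinSum (node M l k) v := fun k hk =>
    spinSum_congr fun i hi => huv i
      (ne_of_lt (hi.trans_le ((node_mono M hl hk).trans hN.le)))
  refine ⟨u, hu, ?_, ?_⟩
  · have hnode : ∀ k ≤ M, ‖(∫ y in 0..(k / M : ℝ), interp l u y) -
        ∫ y in 0..(k / M : ℝ), w y‖ ≤ 3 * δ := by
      intro k hk
      have h1 := norm_integral_interp_sub_le hl u (x := k / M) (by positivity)
      change ‖_ - l • spinSum (node M l k) u‖ ≤ l at h1
      have h2 := hRiem k (Finset.mem_range.2 (by omega))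
      have h3 : ‖l • spinSum (node M l k) u -
          ∑ j ∈ Finset.range k, (l * nodeLen M l j) • A j‖ ≤ δ := by
        rw [huS k hk, hvS k hk, Finset.smul_sum, ← Finset.sum_sub_distrib]
        calc _ ≤ ∑ j ∈ Finset.range k, l * (δ * nodeLen M l j) := by
              refine norm_sum_le_of_le _ fun j hj => ?_
              rw [mul_smul, ← smul_sub, norm_smul, Real.norm_of_nonneg hl.le]
              have := (hb j ((Finset.mem_range.1 hj).trans_le hk)).1
              gcongr
          _ = δ * (l * node M l k) := by
              rw [← sum_nodeLen M hl, Nat.cast_sum, Finset.mul_sum, Finset.mul_sum]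
              exact Finset.sum_congr rfl fun j _ => by ring
          _ ≤ δ * 1 := by
              have h4 := Nat.floor_le (by positivity : 0 ≤ (k / M : ℝ) / l)
              rw [le_div_iff₀ hl] at h4
              have h5 : (k / M : ℝ) ≤ 1 := div_le_one_of_le₀ (by exact_mod_cast hk) hM'.le
              have h6 : l * (node M l k : ℝ) ≤ 1 := by
                rw [mul_comm]; exact h4.trans h5
              gcongr
          _ = δ := mul_one δ
      have h4 := norm_add₃_le (a := (∫ y in 0..(k / M : ℝ), interp l u y) -
          l • spinSum (node M l k) u)
        (b := l • spinSum (node M l k) u - ∑ j ∈ Finset.range k, (l * nodeLen M l j) • A j)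
        (c := ∑ j ∈ Finset.range k, (l * nodeLen M l j) • A j - ∫ y in 0..(k / M : ℝ), w y)
      rw [sub_add_sub_cancel, sub_add_sub_cancel] at h4
      linarith
    intro x hx
    have h1 : (⌊x * M⌋₊ : ℝ) ≤ x * M := Nat.floor_le (mul_nonneg hx.1 hM'.le)
    have h2 := Nat.lt_floor_add_one (x * M)
    set k := ⌊x * M⌋₊
    have hkM : k ≤ M := by
      have : (k : ℝ) ≤ M := h1.trans (mul_le_of_le_one_left hM'.le hx.2)
      exact_mod_cast this
    have hkx : (k / M : ℝ) ≤ x := (div_le_iff₀ hM').2 h1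
    have hxk : x - k / M ≤ 1 / M := by
      rw [sub_le_iff_le_add, ← add_div, le_div_iff₀ hM']
      linarith
    have h3 := norm_integral_sub_integral_le (intervalIntegrable_interp l u 0 1)
      (ae_of_all _ fun y => (norm_interp l u y).le) (by positivity) hkx hx.2
    have h4 := norm_integral_sub_integral_le hwI hw1 (by positivity) hkx hx.2
    rw [norm_sub_rev] at h4
    have h5 := norm_add₃_le (a := (∫ y in 0..x, interp l u y) -
        ∫ y in 0..(k / M : ℝ), interp l u y)
      (b := (∫ y in 0..(k / M : ℝ), interp l u y) - ∫ y in 0..(k / M : ℝ), w y)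
      (c := (∫ y in 0..(k / M : ℝ), w y) - ∫ y in 0..x, w y)
    rw [sub_add_sub_cancel, sub_add_sub_cancel] at h5
    have h6 := hnode k hkM
    linarith
  · refine le_trans ?_ hEn
    have h1 := chainEnergy_le_partialEnergy hJ huv
    rw [hN] at hvE
    have h2 : ∑ j ∈ Finset.range M, (partialEnergy J (nodeLen M l j) (b j) + interfaceCost J) ≤
        ∑ j ∈ Finset.range M, nodeLen M l j * (t j + δ) :=
      Finset.sum_le_sum fun j hj => (hb j (Finset.mem_range.1 hj)).2
    simp only [mul_assoc]
    rw [← Finset.mul_sum, ← mul_add]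
    gcongr
    linarith

/-! ### Diagonal argument and the two Γ-inequalities -/

/-- For large n, κ n is the largest k ≤ n whose threshold has already been passed by n. -/
lemma exists_diagonal {Q : ℕ → ℕ → Prop} (h : ∀ k, ∀ᶠ n in atTop, Q k n) :
    ∃ κ : ℕ → ℕ, Tendsto κ atTop atTop ∧ ∀ᶠ n in atTop, Q (κ n) n := by
  classical
  choose N hN using fun k => eventually_atTop.1 (h k)
  refine ⟨fun n => Nat.findGreatest (fun k => N k ≤ n) n, ?_, ?_⟩
  · rw [tendsto_atTop]
    intro K
    filter_upwards [eventually_ge_atTop K, eventually_ge_atTop (N K)] with n h1 h2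
    exact Nat.le_findGreatest h1 h2
  · filter_upwards [eventually_ge_atTop (N 0)] with n hn
    exact hN _ _ (Nat.findGreatest_spec (P := fun k => N k ≤ n) (Nat.zero_le n) hn)

lemma exists_LInfI_interp (lam : ℝ) (v : Spins) :
    ∃ u : LInfI, (u : ℝ → Plane) =ᵐ[volI] interp lam v := by
  have h : MemLp (interp lam v) ⊤ volI :=
    memLp_top_of_bound (measurable_interp lam v).aestronglyMeasurable 1
      (ae_of_all _ fun x => (norm_interp lam v x).le)
  exact ⟨h.toLp _, h.coeFn_toLp⟩

lemma le_liminf_energy {J : ℝ} (hJ : 0 ≤ J) {lam : ℕ → ℝ} (hpos : ∀ n, 0 < lam n)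
    (hlam : Tendsto lam atTop (𝓝 0)) {w : LInfI} {u : ℕ → LInfI} (hu : WeakStarTendsto u w) :
    bulkEnergy (homDensity J) w ≤ liminf (fun n => energy J (lam n) (u n)) atTop := by
  by_contra hlt
  obtain ⟨a, ha1, ha2⟩ := EReal.lt_iff_exists_real_btwn.1 (not_le.1 hlt)
  -- If the inequality failed, a subsequence would have energies below a; these are finite, so
  -- actual spin configurations underlie it.
  obtain ⟨φ, hφ, hφa⟩ := extraction_of_frequently_atTop
    (frequently_lt_of_liminf_lt (by isBoundedDefault) ha1)
  have hex : ∀ n, ∃ v : Spins, (u (φ n) : ℝ → Plane) =ᵐ[volI] interp (lam (φ n)) v ∧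
      lam (φ n) * chainEnergy J ⌊1 / lam (φ n)⌋₊ v < a := fun n => by
    have h := hφa n
    simp only [energy, iInf_lt_iff, EReal.coe_lt_coe_iff] at h
    obtain ⟨v, _, hv, hva⟩ := h
    exact ⟨v, hv, hva⟩
  choose v hv hva using hex
  obtain ⟨hw1, hle⟩ := integral_homDensity_le_of_energy_le hJ (lam := lam ∘ φ)
    (fun n => hpos _) (hlam.comp hφ.tendsto_atTop) (v := v) (integrable_of_LInfI w)
    (fun x hx => ((hu.tendsto_integral hx).comp hφ.tendsto_atTop).congr fun n =>
      intervalIntegral_congr_volI (hv n) hx) (fun n => (hva n).le)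
  rw [bulkEnergy, if_pos hw1, EReal.coe_lt_coe_iff] at ha2
  linarith

lemma exists_recovery_sequence {J : ℝ} (hJ : 0 ≤ J) {lam : ℕ → ℝ} (hpos : ∀ n, 0 < lam n)
    (hlam : Tendsto lam atTop (𝓝 0)) (w : LInfI) :
    ∃ u : ℕ → LInfI, WeakStarTendsto u w ∧
      limsup (fun n => energy J (lam n) (u n)) atTop ≤ bulkEnergy (homDensity J) w := by
  by_cases hw1 : ∀ᵐ x ∂volI, ‖w x‖ ≤ 1
  swap
  · refine ⟨fun _ => w, fun g _ => tendsto_const_nhds, ?_⟩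
    rw [bulkEnergy, if_neg hw1]
    exact le_top
  obtain ⟨κ, hκ, hκQ⟩ := exists_diagonal fun k : ℕ => eventually_exists_recovery hJ hpos hlam
    (integrable_of_LInfI w) hw1 (ε := 1 / ((k : ℝ) + 1)) (by positivity)
  have hε : Tendsto (fun n => 1 / ((κ n : ℝ) + 1)) atTop (𝓝 0) :=
    tendsto_one_div_add_atTop_nhds_zero_nat.comp hκ
  have hex : ∀ n, ∃ u : LInfI, (∀ᵐ x ∂volI, ‖u x‖ ≤ 1) ∧
      ((∃ v, PeriodicBC ⌊1 / lam n⌋₊ v ∧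
        (∀ x ∈ Set.Icc (0 : ℝ) 1, ‖(∫ y in 0..x, interp (lam n) v y) - ∫ y in 0..x, w y‖ ≤
          1 / ((κ n : ℝ) + 1)) ∧
        lam n * chainEnergy J ⌊1 / lam n⌋₊ v ≤
          ∫ x, homDensity J (w x) ∂volI + 1 / ((κ n : ℝ) + 1)) →
        (∀ x ∈ Set.Icc (0 : ℝ) 1, ‖(∫ y in 0..x, u y) - ∫ y in 0..x, w y‖ ≤
          1 / ((κ n : ℝ) + 1)) ∧
        energy J (lam n) u ≤
          ((∫ x, homDensity J (w x) ∂volI + 1 / ((κ n : ℝ) + 1) : ℝ) : EReal)) := fun n => by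
    by_cases h : ∃ v, PeriodicBC ⌊1 / lam n⌋₊ v ∧
        (∀ x ∈ Set.Icc (0 : ℝ) 1, ‖(∫ y in 0..x, interp (lam n) v y) - ∫ y in 0..x, w y‖ ≤
          1 / ((κ n : ℝ) + 1)) ∧
        lam n * chainEnergy J ⌊1 / lam n⌋₊ v ≤
          ∫ x, homDensity J (w x) ∂volI + 1 / ((κ n : ℝ) + 1)
    · obtain ⟨v, hv, hvx, hvE⟩ := h
      obtain ⟨u, hu⟩ := exists_LInfI_interp (lam n) v
      refine ⟨u, ?_, fun _ => ⟨fun x hx => ?_, ?_⟩⟩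
      · filter_upwards [hu] with x hx
        rw [hx, norm_interp]
      · rw [intervalIntegral_congr_volI hu hx]
        exact hvx x hx
      · exact iInf_le_of_le v (iInf_le_of_le hv (iInf_le_of_le hu (EReal.coe_le_coe_iff.2 hvE)))
    · exact ⟨w, hw1, fun h' => absurd h' h⟩
  choose u hu1 hu using hex
  refine ⟨u, weakStarTendsto_of_tendsto_integral hu1 hw1 fun x hx => ?_, ?_⟩
  · rw [tendsto_iff_norm_sub_tendsto_zero]
    refine squeeze_zero' (Eventually.of_forall fun n => norm_nonneg _) ?_ hε
    filter_upwards [hκQ] with n hn using (hu n hn).1 x hx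
  · rw [bulkEnergy, if_pos hw1]
    have hlim : Tendsto (fun n => ((∫ x, homDensity J (w x) ∂volI + 1 / ((κ n : ℝ) + 1) : ℝ) :
        EReal)) atTop (𝓝 ((∫ x, homDensity J (w x) ∂volI : ℝ) : EReal)) := by
      refine (continuous_coe_real_ereal.tendsto _).comp ?_
      simpa using (tendsto_const_nhds (x := ∫ x, homDensity J (w x) ∂volI)).add hε
    rw [← hlim.limsup_eq]
    exact limsup_le_limsup (by filter_upwards [hκQ] with n hn using (hu n hn).2)

lemma bulkEnergy_zero (f : Plane → ℝ) : bulkEnergy f 0 = ((f 0 : ℝ) : EReal) := by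
  have h0 : ((0 : LInfI) : ℝ → Plane) =ᵐ[volI] fun _ => 0 := Lp.coeFn_zero _ _ _
  have h1 : ∀ᵐ x ∂volI, ‖(0 : LInfI) x‖ ≤ 1 := by
    filter_upwards [h0] with x hx
    rw [hx, norm_zero]
    exact zero_le_one
  have h2 : ∫ x, f ((0 : LInfI) x) ∂volI = ∫ _x, f 0 ∂volI :=
    integral_congr_ae (by filter_upwards [h0] with x hx; rw [hx])
  rw [bulkEnergy, if_pos h1, h2]
  simp

lemma coe_le_bulkEnergy {J : ℝ} (hJ : 0 ≤ J) {c : ℝ}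
    (hc : ∀ z : Plane, ‖z‖ ≤ 1 → c ≤ homDensity J z) (u : LInfI) :
    (c : EReal) ≤ bulkEnergy (homDensity J) u := by
  by_cases hu : ∀ᵐ x ∂volI, ‖u x‖ ≤ 1
  · rw [bulkEnergy, if_pos hu, EReal.coe_le_coe_iff]
    have : ∫ _x, c ∂volI ≤ ∫ x, homDensity J (u x) ∂volI :=
      integral_mono_ae (integrable_const _)
        (integrable_homDensity hJ (integrable_of_LInfI u).1 hu)
        (by filter_upwards [hu] with x hx using hc _ hx)
    simpa using this
  · rw [bulkEnergy, if_neg hu]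
    exact le_top

end SpinChain

end

theorem theorem3p3 (J₁ : ℝ) (hJ₁ : 0 ≤ J₁) :
    ∃ fhom : SpinChain.Plane → ℝ,
      -- the homogenization formula, on the closed unit ball
      (∀ z ∈ Metric.closedBall (0 : SpinChain.Plane) 1, SpinChain.IsHomLimit J₁ z (fhom z)) ∧
      ConvexOn ℝ (Metric.closedBall (0 : SpinChain.Plane) 1) fhom ∧
      -- the limit functional is given by a convergent integral
      (∀ u : SpinChain.LInfI, (∀ᵐ x ∂SpinChain.volI, ‖u x‖ ≤ 1) →
        Integrable (fun x => fhom (u x)) SpinChain.volI) ∧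
      -- Gamma-convergence, for every vanishing sequence of lattice spacings
      (∀ lam : ℕ → ℝ, (∀ n, 0 < lam n) → Tendsto lam atTop (𝓝 0) →
        SpinChain.IsGammaLimit (fun n => SpinChain.energy J₁ (lam n))
          (SpinChain.bulkEnergy fhom)) ∧
      -- (i)
      (4 ≤ J₁ → ∀ z ∈ Metric.closedBall (0 : SpinChain.Plane) 1, fhom z = -(J₁ - 1)) ∧
      -- (ii)
      (0 < J₁ → J₁ ≤ 4 →
        (∀ z ∈ Metric.closedBall (0 : SpinChain.Plane) 1,
          (J₁ - 4) ^ 2 / 8 * ‖z‖ ^ 2 ≤ fhom z + (1 + J₁ ^ 2 / 8) ∧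
          fhom z + (1 + J₁ ^ 2 / 8) ≤ (J₁ - 4) ^ 2 / 8 * ‖z‖) ∧
        ∃ h : ℝ → ℝ, ConvexOn ℝ (Set.Icc 0 1) h ∧ MonotoneOn h (Set.Icc 0 1) ∧
          ∀ z ∈ Metric.closedBall (0 : SpinChain.Plane) 1, fhom z = h ‖z‖) ∧
      -- (iii)
      (0 < J₁ → J₁ ≤ 4 →
        SpinChain.bulkEnergy fhom 0 = ((-(1 + J₁ ^ 2 / 8) : ℝ) : EReal) ∧
        ∀ u : SpinChain.LInfI, SpinChain.bulkEnergy fhom 0 ≤ SpinChain.bulkEnergy fhom u) := by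
  refine ⟨SpinChain.homDensity J₁, fun z hz => ?_, SpinChain.convexOn_homDensity hJ₁,
    fun u hu => ?_, fun lam hpos hlam => ⟨fun w u hu => ?_, fun w => ?_⟩, fun h4 z hz => ?_,
    fun _ h4 => ⟨fun z hz => ?_, SpinChain.exists_radial hJ₁⟩, fun _ h4 => ?_⟩
  · exact SpinChain.isHomLimit_homDensity hJ₁ (mem_closedBall_zero_iff.1 hz)
  · exact SpinChain.integrable_homDensity hJ₁ (SpinChain.integrable_of_LInfI u).1 hu
  · exact SpinChain.le_liminf_energy hJ₁ hpos hlam hu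
  · exact SpinChain.exists_recovery_sequence hJ₁ hpos hlam w
  · exact SpinChain.homDensity_eq_of_four_le h4 (mem_closedBall_zero_iff.1 hz)
  · rw [mem_closedBall_zero_iff] at hz
    exact ⟨SpinChain.quadratic_le_homDensity hJ₁ hz, SpinChain.homDensity_le_linear hJ₁ h4 hz⟩
  · rw [SpinChain.bulkEnergy_zero, SpinChain.homDensity_zero hJ₁ h4]
    refine ⟨rfl, SpinChain.coe_le_bulkEnergy hJ₁ fun z hz => ?_⟩
    have h1 := SpinChain.quadratic_le_homDensity hJ₁ hz
    have h2 : 0 ≤ (J₁ - 4) ^ 2 / 8 * ‖z‖ ^ 2 := by positivity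
    linarith
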